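/- Let $R$ be a commutative ring and $n\ge 1$. Let $W_n$ be the group of permutations $w$ of $I_n=\{\pm1,\dots,\pm n\}$ with $w(-i)=-w(i)$, let $t_i=(i,-i)$, $s_i=(i,i+1)(-i,-i-1)$, $S_{-n}=\{s_1,\dots,s_{n-1}\}$, $S_n=\{t_1\}\cup S_{-n}$, and let $\ell$ be the length function of $W_n$ with respect to $S_n$. A signed composition of $n$ is a finite sequence $C=(c_1,\dots,c_r)$ of non-zero integers with $\sum|c_i|=n$; it is semi-positive if $c_i\ge -1$ for all $i$. Let $I_{C,+}^{(i)}=\{k : |c_1|+\dots+|c_{i-1}|+1\le k\le |c_1|+\dots+|c_i|\}$, and let $I_C^{(i)}=I_{C,+}^{(i)}$ if $c_i<0$ and $I_C^{(i)}=I_{C,+}^{(i)}\cup -I_{C,+}^{(i)}$ if $c_i>0$. Put $$W_C=\{w\in W_n : w(I_C^{(i)})=I_C^{(i)}\ \forall i\},\qquad S_C=(S_{-n}\cap W_C)\cup\{t_{|c_1|+\dots+|c_{j-1}|+1} : c_j>0\},$$ $$X_C=\{x\in W_n : \ell(xw)\ge\ell(x)\ \forall w\in W_C\},\qquad X_{CD}=X_C^{-1}\cap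 X_D .$$ Write $C\subset D$ if $W_C\subset W_D$. For $C\subset D$ put $X_C^D=X_C\cap W_D$ and $X_{CC'}^D=X_{CC'}\cap W_D$. Let $x_C=\sum_{w\in X_C}w\in RW_n$ and $x_C^D=\sum_{w\in X_C^D}w\in RW_D\subset RW_n$, and let $R\Sigma'(W_n)$ and $R\Sigma'(W_D)$ be the $R$-spans of the $x_C$ (all signed compositions $C$ of $n$) and of the $x_C^D$ (all $C\subset D$), respectively. For a finite group $G$ let $R\,\mathrm{Irr}\,G=R\otimes_{\mathbb Z}\mathbb Z\,\mathrm{Irr}\,G$, where $\mathbb Z\,\mathrm{Irr}\,G$ is the ring of virtual complex characters of $G$. Let $D$ be a semi-positive signed composition of $n$. Then for every signed composition $C$ of $n$ and every $d\in X_{CD}$ there is a unique signed composition ${}^{d^{-1}}C\cap D$ of $n$ with $W_{{}^{d^{-1}}C\cap D}=d^{-1}W_Cd\cap W_D$, and there are unique $R$-linear maps $$\theta_n:R\Sigma'(W_n)\to R\,\mathrm{Irr}\,W_n,\ x_C\mapsto \mathrm{Ind}_{W_C}^{W_n}1;\qquad \theta_D:R\Sigma'(W_D)\to R\,\mathrm{Irr}\,W_D,\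 x_C^D\mapsto \mathrm{Ind}_{W_C}^{W_D}1\ (C\subset D);$$ $$\mathrm{Res}_D:R\Sigma'(W_n)\to R\Sigma'(W_D),\ x_C\mapsto\sum_{d\in X_{CD}}x^D_{{}^{d^{-1}}C\cap D}.$$ Moreover: (a) $x_D\,\mathrm{Res}_D(x)=x\,x_D$ for every $x\in R\Sigma'(W_n)$. (b) $R\Sigma'(W_n)$ and $R\Sigma'(W_D)$ are unital $R$-subalgebras of $RW_n$, and $\mathrm{Res}_D$ is a morphism of $R$-algebras. (c) If $C\subset D$ is also semi-positive, then there is a unique $R$-linear map $\mathrm{Res}_C^D:R\Sigma'(W_D)\to R\Sigma'(W_C)$ with $x_E^D\mapsto\sum_{d\in X_{EC}^D}x^C_{{}^{d^{-1}}E\cap C}$ for all $E\subset D$, and $\mathrm{Res}_C^D\circ\mathrm{Res}_D=\mathrm{Res}_C$. (d) $\mathrm{Res}^{W_n}_{W_D}\circ\theta_n=\theta_D\circ\mathrm{Res}_D$, where $\mathrm{Res}^{W_n}_{W_D}:R\,\mathrm{Irr}\,W_n\to R\,\mathrm{Irr}\,W_D$ is restriction of characters. (e) If $D'$ is a signed composition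 of $n$ and $d\in X_{DD'}$ satisfies $dS_{D'}d^{-1}=S_D$, then $D'$ is semi-positive, $y\mapsto dyd^{-1}$ defines a map $d_*:R\Sigma'(W_{D'})\to R\Sigma'(W_D)$, and $d_*\circ\mathrm{Res}_{D'}=\mathrm{Res}_D$. -/

import Mathlib

open scoped TensorProduct

noncomputable section

namespace MantaciReutenauer

/-! ### The Weyl group of type B -/

/-- The set `{±1, …, ±n}`. -/
def I (n : ℕ) : Type := {k : ℤ // k ≠ 0 ∧ |k| ≤ n}

instance (n : ℕ) : DecidableEq (I n) := inferInstanceAs (DecidableEq {k : ℤ // k ≠ 0 ∧ |k| ≤ n})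

instance (n : ℕ) : Neg (I n) := ⟨fun k => ⟨-k.1, by simpa using k.2⟩⟩

instance (n : ℕ) : Finite (I n) :=
  Finite.of_injective (β := Set.Icc (-(n : ℤ)) n) (fun k => ⟨k.1, abs_le.mp k.2.2⟩)
    fun _ _ h => Subtype.ext (congrArg (fun z : Set.Icc (-(n : ℤ)) n => (z : ℤ)) h)

/-- `W_n` inside the symmetric group of `{±1, …, ±n}`. -/
def hyperoctahedral (n : ℕ) : Subgroup (Equiv.Perm (I n)) where
  carrier := {σ | ∀ i, σ (-i) = -σ i}
  one_mem' := fun _ => rfl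
  mul_mem' := fun {a b} ha hb i => by
    change a (b (-i)) = -a (b i)
    rw [hb, ha]
  inv_mem' := fun {a} ha i => by
    rw [Equiv.Perm.inv_eq_iff_eq, ha]
    simp

/-- The Weyl group `W_n` of type `B_n`. -/
abbrev W (n : ℕ) : Type := hyperoctahedral n

instance (n : ℕ) : Fintype (W n) := Fintype.ofFinite _

variable {n : ℕ}

/-- The underlying permutation of an element of `W_n`. -/
def perm (w : W n) : Equiv.Perm (I n) := w.1

/-- `w` is the reflection `t_k = (k, -k)`. -/
def IsT (k : ℤ) (w : W n) : Prop := ∃ a : I n, a.1 = k ∧ perm w = Equiv.swap a (-a)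

/-- `w` is the reflection `s_k = (k, k+1)(-k, -k-1)`. -/
def IsS (k : ℤ) (w : W n) : Prop :=
  ∃ a b : I n, a.1 = k ∧ b.1 = k + 1 ∧ perm w = Equiv.swap a b * Equiv.swap (-a) (-b)

/-- `S_{-n} = {s_1, …, s_{n-1}}`. -/
def Sminus (n : ℕ) : Set (W n) := {w | ∃ k : ℤ, 1 ≤ k ∧ IsS k w}

/-- `S_n = {t, s_1, …, s_{n-1}}` with `t = t_1`. -/
def S (n : ℕ) : Set (W n) := {w | IsT 1 w} ∪ Sminus n

/-- The length function of `(W_n, S_n)`: the least length of a word in `S_n` with product `w`. -/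
def len (w : W n) : ℕ := sInf {k | ∃ l : List (W n), (∀ s ∈ l, s ∈ S n) ∧ l.prod = w ∧ l.length = k}

/-! ### Signed compositions and the subgroups attached to them -/

/-- Signed compositions of `n`. -/
structure SignedComp (n : ℕ) where
  parts : List ℤ
  ne_zero : ∀ c ∈ parts, c ≠ 0
  sum_eq : (parts.map Int.natAbs).sum = n

namespace SignedComp

/-- All parts are at least `-1`. -/
def SemiPositive (C : SignedComp n) : Prop := ∀ c ∈ C.parts, -1 ≤ c

/-- `|c_1| + ⋯ + |c_{i-1}|` (parts indexed from `0`). -/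
def offset (C : SignedComp n) (i : Fin C.parts.length) : ℕ :=
  ((C.parts.take i).map Int.natAbs).sum

/-- `{k : |c_1| + ⋯ + |c_{i-1}| + 1 ≤ k ≤ |c_1| + ⋯ + |c_i|}`. -/
def blockPlus (C : SignedComp n) (i : Fin C.parts.length) : Set (I n) :=
  {k | (C.offset i : ℤ) + 1 ≤ k.1 ∧ k.1 ≤ C.offset i + |C.parts.get i|}

/-- The block `I_C^{(i)}`, which is symmetric under negation when the `i`-th part is positive. -/
def block (C : SignedComp n) (i : Fin C.parts.length) : Set (I n) :=
  {k | k ∈ C.blockPlus i ∨ (0 < C.parts.get i ∧ -k ∈ C.blockPlus i)}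

/-- The reflection subgroup `W_C`: the elements that stabilize all blocks. -/
def subgroup (C : SignedComp n) : Subgroup (W n) where
  carrier := {w | ∀ i, perm w '' C.block i = C.block i}
  one_mem' := fun i => by
    change (fun x => x) '' C.block i = C.block i
    simp
  mul_mem' := fun {a b} ha hb i => by
    change (fun x => perm a (perm b x)) '' C.block i = C.block i
    rw [← Set.image_image, hb, ha]
  inv_mem' := fun {a} ha i => by
    conv_lhs => rw [← ha i]
    change (perm a).symm '' _ = _
    simp [Set.image_image]

/-- `S_C = (S_{-n} ∩ W_C) ∪ {t_{|c_1| + ⋯ + |c_{j-1}| + 1} : c_j > 0}`. -/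
def simple (C : SignedComp n) : Set (W n) :=
  (Sminus n ∩ C.subgroup) ∪ {w | ∃ j, 0 < C.parts.get j ∧ IsT ((C.offset j : ℤ) + 1) w}

/-- `C ⊂ D` means `W_C ⊂ W_D`. -/
instance : HasSubset (SignedComp n) := ⟨fun C D => C.subgroup ≤ D.subgroup⟩

/-- `X_C = {x : ℓ(xw) ≥ ℓ(x) for all w ∈ W_C}`. -/
def X (C : SignedComp n) : Set (W n) := {x | ∀ w ∈ C.subgroup, len x ≤ len (x * w)}

/-- `X_{CD} = X_C⁻¹ ∩ X_D`. -/
def XX (C D : SignedComp n) : Set (W n) := {d | d⁻¹ ∈ C.X ∧ d ∈ D.X}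

/-- `E` is the signed composition `d⁻¹C ∩ D`, that is `W_E = d⁻¹ W_C d ∩ W_D`. -/
def IsConjInter (C : SignedComp n) (d : W n) (D E : SignedComp n) : Prop :=
  E.subgroup = C.subgroup.map (MulAut.conj d⁻¹).toMonoidHom ⊓ D.subgroup

open Classical in
/-- The signed composition `d⁻¹C ∩ D` (the value is `D` if there is none). -/
def conjInter (C : SignedComp n) (d : W n) (D : SignedComp n) : SignedComp n :=
  if h : ∃ E, IsConjInter C d D E then h.choose else D

end SignedComp

open SignedComp

/-! ### Mantaci–Reutenauer algebras -/

open Classical in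
/-- The sum in `R W_n` of the elements of a subset of `W_n`. -/
def setSum (R : Type*) [CommRing R] (A : Set (W n)) : MonoidAlgebra R (W n) :=
  ∑ w : W n with w ∈ A, MonoidAlgebra.of R (W n) w

/-- `x_C`. -/
def xElem (R : Type*) [CommRing R] (C : SignedComp n) : MonoidAlgebra R (W n) := setSum R C.X

/-- `x_C^D`, the sum of the elements of `X_C^D = X_C ∩ W_D`; we regard `R W_D ⊂ R W_n`. -/
def xRel (R : Type*) [CommRing R] (D C : SignedComp n) : MonoidAlgebra R (W n) :=
  setSum R (C.X ∩ D.subgroup)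

/-- `RΣ'(W_n)`, the `R`-span of the `x_C`. -/
def Sig (R : Type*) [CommRing R] (n : ℕ) : Submodule R (MonoidAlgebra R (W n)) :=
  Submodule.span R {y | ∃ C : SignedComp n, y = xElem R C}

/-- `RΣ'(W_D)`, the `R`-span of the `x_C^D` with `C ⊂ D`. -/
def SigRel (R : Type*) [CommRing R] (D : SignedComp n) : Submodule R (MonoidAlgebra R (W n)) :=
  Submodule.span R {y | ∃ C : SignedComp n, C ⊆ D ∧ y = xRel R D C}

/-- `x_C` as an element of `RΣ'(W_n)`. -/
def xSig (R : Type*) [CommRing R] (C : SignedComp n) : Sig R n :=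
  ⟨xElem R C, Submodule.subset_span ⟨C, rfl⟩⟩

/-- `x_C^D` as an element of `RΣ'(W_D)`. -/
def xSigRel (R : Type*) [CommRing R] (D C : SignedComp n) (h : C ⊆ D) : SigRel R D :=
  ⟨xRel R D C, Submodule.subset_span ⟨C, h, rfl⟩⟩

/-! ### Restriction maps -/

open Classical in
/-- The defining property of `Res_D`: `x_C ↦ ∑_{d ∈ X_{CD}} x^D_{d⁻¹C ∩ D}` for all `C`. -/
def IsRes (R : Type*) [CommRing R] (D : SignedComp n) (f : Sig R n →ₗ[R] SigRel R D) : Prop :=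
  ∀ C : SignedComp n, (f (xSig R C) : MonoidAlgebra R (W n)) =
    ∑ d : W n with d ∈ XX C D, xRel R D (conjInter C d D)

open Classical in
/-- `Res_D`, the linear map with the property `IsRes` (and zero if there is none). -/
def Res (R : Type*) [CommRing R] (D : SignedComp n) : Sig R n →ₗ[R] SigRel R D :=
  if h : ∃ f, IsRes R D f then h.choose else 0

open Classical in
/-- The defining property of `Res_C^D`:
`x_E^D ↦ ∑_{d ∈ X_{EC} ∩ W_D} x^C_{d⁻¹E ∩ C}` for all `E ⊂ D`. -/
def IsResRel (R : Type*) [CommRing R] (D C : SignedComp n) (f : SigRel R D →ₗ[R] SigRel R C) :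
    Prop :=
  ∀ (E : SignedComp n) (h : E ⊆ D), (f (xSigRel R D E h) : MonoidAlgebra R (W n)) =
    ∑ d : W n with d ∈ XX E C ∩ D.subgroup, xRel R C (conjInter E d C)

open Classical in
/-- `Res_C^D`, the linear map with the property `IsResRel` (and zero if there is none). -/
def ResRel (R : Type*) [CommRing R] (D C : SignedComp n) : SigRel R D →ₗ[R] SigRel R C :=
  if h : ∃ f, IsResRel R D C f then h.choose else 0

/-! ### Character rings -/

/-- The characters of the finite-dimensional complex representations of `G`. -/
def characters (G : Type) [Group G] : Set (G → ℂ) := {χ | ∃ V : FDRep ℂ G, χ = V.character}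

/-- The character ring `ℤ Irr G`: the integral linear combinations of characters. -/
def charRing (G : Type) [Group G] : Subring (G → ℂ) where
  __ := AddSubgroup.closure (characters G)
  one_mem' := by
    refine AddSubgroup.subset_closure ⟨FDRep.of (1 : Representation ℂ G ℂ), ?_⟩
    funext g
    change 1 = LinearMap.trace ℂ ℂ (1 : Module.End ℂ ℂ)
    simp
  mul_mem' := fun {a b} ha hb => by
    change a * b ∈ AddSubgroup.closure (characters G)
    change a ∈ AddSubgroup.closure (characters G) at ha
    change b ∈ AddSubgroup.closure (characters G) at hb
    induction ha using AddSubgroup.closure_induction with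
    | mem a ha =>
      induction hb using AddSubgroup.closure_induction with
      | mem b hb =>
        obtain ⟨V, rfl⟩ := ha
        obtain ⟨V', rfl⟩ := hb
        exact AddSubgroup.subset_closure
          ⟨CategoryTheory.MonoidalCategoryStruct.tensorObj V V', (FDRep.char_tensor V V').symm⟩
      | zero => simp
      | add c d _ _ hc hd => rw [mul_add]; exact add_mem hc hd
      | neg c _ hc => rw [mul_neg]; exact neg_mem hc
    | zero => simp
    | add c d _ _ hc hd => rw [add_mul]; exact add_mem hc hd
    | neg c _ hc => rw [neg_mul]; exact neg_mem hc

/-- `R Irr G = R ⊗_ℤ ℤ Irr G`. -/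
abbrev RIrr (R : Type*) [CommRing R] (G : Type) [Group G] := R ⊗[ℤ] charRing G

/-- Restriction of characters to a subgroup. -/
def resChar {G : Type} [Group G] (H : Subgroup G) : charRing G →+* charRing H where
  toFun χ := ⟨fun h => χ.1 h, by
    obtain ⟨a, ha⟩ := χ
    change a ∈ AddSubgroup.closure (characters G) at ha
    change (fun h : H => a h) ∈ AddSubgroup.closure (characters H)
    induction ha using AddSubgroup.closure_induction with
    | mem a ha =>
      obtain ⟨V, rfl⟩ := ha
      exact AddSubgroup.subset_closure ⟨FDRep.of (V.ρ.comp H.subtype), rfl⟩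
    | zero => exact zero_mem _
    | add c d _ _ hc hd => exact add_mem hc hd
    | neg c _ hc => exact neg_mem hc⟩
  map_one' := rfl
  map_mul' _ _ := rfl
  map_zero' := rfl
  map_add' _ _ := rfl

/-- Restriction `R Irr G → R Irr H`. -/
def resRIrr (R : Type*) [CommRing R] {G : Type} [Group G] (H : Subgroup G) :
    RIrr R G →ₐ[R] RIrr R H :=
  Algebra.TensorProduct.map (AlgHom.id R R) (resChar H).toIntAlgHom

open Classical in
/-- Induction of class functions:
`(Ind φ)(g) = |H|⁻¹ ∑_{y ∈ G, y⁻¹ g y ∈ H} φ(y⁻¹ g y)`. -/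
def indFun {G : Type} [Group G] [Finite G] (H : Subgroup G) (φ : H → ℂ) (g : G) : ℂ :=
  letI := Fintype.ofFinite G
  (Nat.card H : ℂ)⁻¹ * ∑ y : G, if h : y⁻¹ * g * y ∈ H then φ ⟨y⁻¹ * g * y, h⟩ else 0

theorem indFun_one_mem {G : Type} [Group G] [Finite G] (H : Subgroup G) :
    indFun H (fun _ => 1) ∈ charRing G := by
  classical
  let _ := Fintype.ofFinite G
  let _ := Fintype.ofFinite (G ⧸ H)
  refine AddSubgroup.subset_closure
    ⟨FDRep.of (Representation.ofMulAction ℂ G (G ⧸ H)), ?_⟩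
  funext g
  change _ = LinearMap.trace ℂ (MonoidAlgebra ℂ (G ⧸ H)) (Representation.ofMulAction ℂ G (G ⧸ H) g)
  rw [LinearMap.trace_eq_matrix_trace ℂ (MonoidAlgebra.basis (G ⧸ H) ℂ), Matrix.trace]
  have h1 : ∀ q : G ⧸ H, Matrix.diag (LinearMap.toMatrix (MonoidAlgebra.basis (G ⧸ H) ℂ)
      (MonoidAlgebra.basis (G ⧸ H) ℂ) (Representation.ofMulAction ℂ G (G ⧸ H) g)) q
      = if g • q = q then 1 else 0 := by
    intro q
    rw [Matrix.diag_apply, LinearMap.toMatrix_apply, MonoidAlgebra.basis_apply,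
      Representation.ofMulAction_single]
    exact Finsupp.single_apply
  simp only [h1]
  have h2 : ∀ y : G, (if h : y⁻¹ * g * y ∈ H then (1 : ℂ) else 0)
      = if g • (y : G ⧸ H) = (y : G ⧸ H) then 1 else 0 := by
    intro y
    have : g • (y : G ⧸ H) = (y : G ⧸ H) ↔ y⁻¹ * g * y ∈ H := by
      rw [eq_comm, MulAction.Quotient.smul_coe, QuotientGroup.eq, smul_eq_mul, mul_assoc]
    simp only [this, dite_eq_ite]
  have h3 : indFun H (fun _ => 1) g
      = (Nat.card H : ℂ)⁻¹ * ∑ y : G, if g • (y : G ⧸ H) = (y : G ⧸ H) then (1 : ℂ) else 0 := by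
    simp only [indFun, ← h2]
  rw [h3, Finset.sum_boole, Finset.sum_boole]
  have h4 := QuotientGroup.card_preimage_mk H {q : G ⧸ H | g • q = q}
  rw [Nat.card_eq_fintype_card (α := {q : G ⧸ H | g • q = q}), Nat.card_eq_fintype_card
    (α := (QuotientGroup.mk ⁻¹' {q : G ⧸ H | g • q = q} : Set G)), Fintype.card_subtype,
    Fintype.card_subtype] at h4
  simp only [Set.mem_preimage, Set.mem_ofPred_eq] at h4
  rw [h4]
  have : (Nat.card H : ℂ) ≠ 0 := by exact_mod_cast Nat.card_pos.ne'
  push_cast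
  field_simp

/-- `Ind_H^G 1` in the character ring of `G`. -/
def indOne {G : Type} [Group G] [Finite G] (H : Subgroup G) : charRing G :=
  ⟨indFun H (fun _ => 1), indFun_one_mem H⟩

/-- The defining property of `θ_n`: `x_C ↦ Ind_{W_C}^{W_n} 1` for all `C`. -/
def IsTheta (R : Type*) [CommRing R] (f : Sig R n →ₗ[R] RIrr R (W n)) : Prop :=
  ∀ C : SignedComp n, f (xSig R C) = 1 ⊗ₜ indOne C.subgroup

open Classical in
/-- `θ_n`, the linear map with the property `IsTheta` (and zero if there is none). -/
def theta (R : Type*) [CommRing R] (n : ℕ) : Sig R n →ₗ[R] RIrr R (W n) :=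
  if h : ∃ f, IsTheta R f then h.choose else 0

/-- The defining property of `θ_D`: `x_C^D ↦ Ind_{W_C}^{W_D} 1` for all `C ⊂ D`. -/
def IsThetaRel (R : Type*) [CommRing R] (D : SignedComp n)
    (f : SigRel R D →ₗ[R] RIrr R D.subgroup) : Prop :=
  ∀ (C : SignedComp n) (h : C ⊆ D),
    f (xSigRel R D C h) = 1 ⊗ₜ indOne (C.subgroup.subgroupOf D.subgroup)

open Classical in
/-- `θ_D`, the linear map with the property `IsThetaRel` (and zero if there is none). -/
def thetaRel (R : Type*) [CommRing R] (D : SignedComp n) :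
    SigRel R D →ₗ[R] RIrr R D.subgroup :=
  if h : ∃ f, IsThetaRel R D f then h.choose else 0

end MantaciReutenauer

end

open MantaciReutenauer MantaciReutenauer.SignedComp

/-!
A signed composition `C` is encoded by the equivalence relation on `{±1, …, ±n}` whose classes are
the orbits of `W_C`. Such a relation is compatible with negation (`BlockRel`); the relations that
come from signed compositions are those whose classes meet the positive integers in intervals and
are symmetric as soon as they contain integers of both signs (`BlockRel.IsInterval`), and the
correspondence is bijective (`SignedComp.rel_injective`, `SignedComp.exists_rel_eq`). In these terms
`W_C` is the stabilizer of all classes, and `X_C` consists of the signed permutations that are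
increasing on every class. The latter is the only statement about the length function that is
needed (`BlockRel.mem_incr_iff_len_le`). It follows from the strong exchange property: a
representative of minimal length is increasing on the classes, and each coset `x W_C` contains only
one such element. Conjugation and intersection of the subgroups `W_C` become inverse image and
intersection of relations.

*Existence of the linear maps.* The `x_C` are linearly independent over every ring: for each `C`
there is a `w ∈ X_C` whose signs and descents detect `C`, and this makes the family triangular
(`linearIndependent_bsum`). The `x_C^D` are independent because `x_D x_C^D = x_C`.

*Product formula.* If `D` is semi-positive, the elements `y ∈ X_D` with `w = u y`, `u ∈ X_C`, are in
bijection with the `d ∈ X_{CD}` such that `w ∈ X_E`, where `W_E = d⁻¹ W_C d ∩ W_D`; here `d` is the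
distinguished representative of `W_C y`. Hence `x_C x_D` is the sum of the `x_E`
(`bsum_mul_bsum`), also inside `R W_G` for a relation `G` coarser than `C` and `D`. As
`x_D x_E^D = x_E`, this is (a). Since left multiplication by `x_D` is injective on `RΣ'(W_D)`
(`eq_of_xElem_mul_eq`), the multiplicativity of `Res_D`, its transitivity (c) and its compatibility
with conjugation (e) all follow from (a) and its relative version by cancelling `x_D`.

*Closure under multiplication.* For arbitrary `C` and `D` the product formula fails, so the elements
of `X_C` are sorted further, by the set of places at which they take positive values
(`BlockRel.signedIncr`). The sums of these smaller sets span the same module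
(`setSum_signedIncr_mem`), and up to such a set one may assume that no class of `C` contains
integers of both signs; the argument for the product formula then works for every `D`.

*Characters.* The set `X_{CD}` is a system of representatives of the double cosets of `W_C` and
`W_D` (`BlockRel.eq_one_of_double_coset`), so (d) is the Mackey formula for permutation characters
(`resChar_indOne`).
-/

open MantaciReutenauer MantaciReutenauer.SignedComp

noncomputable section

namespace MantaciReutenauer

open scoped Classical

variable {n : ℕ}

/-! ### Signed permutations and reflections -/

@[simp] lemma val_neg (a : I n) : (-a).1 = -a.1 := rfl

lemma I.ext' {a b : I n} (h : a.1 = b.1) : a = b := Subtype.ext h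

lemma val_ne_zero (a : I n) : a.1 ≠ 0 := a.2.1

lemma val_le (a : I n) : a.1 ≤ n := (abs_le.1 a.2.2).2

lemma neg_le_val (a : I n) : -(n : ℤ) ≤ a.1 := (abs_le.1 a.2.2).1

@[simp] lemma neg_neg' (a : I n) : - -a = a := I.ext' (by simp)

lemma val_ne_of_ne {a b : I n} (h : a ≠ b) : a.1 ≠ b.1 := fun h' => h (I.ext' h')

/-- The element of `{±1, …, ±n}` with a given positive value. -/
def mkPos (k : ℤ) (h1 : 1 ≤ k) (h2 : k ≤ n) : I n :=
  ⟨k, by omega, by rw [abs_le]; omega⟩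

@[simp] lemma mkPos_val (k : ℤ) (h1 : 1 ≤ k) (h2 : k ≤ n) : (mkPos k h1 h2 : I n).1 = k := rfl

lemma perm_mul (x y : W n) (a : I n) : perm (x * y) a = perm x (perm y a) := rfl

@[simp] lemma perm_one (a : I n) : perm (1 : W n) a = a := rfl

@[simp] lemma perm_neg (w : W n) (a : I n) : perm w (-a) = -perm w a := w.2 a

@[simp] lemma perm_inv_perm (w : W n) (a : I n) : perm w⁻¹ (perm w a) = a :=
  (perm w).symm_apply_apply a

@[simp] lemma perm_perm_inv (w : W n) (a : I n) : perm w (perm w⁻¹ a) = a :=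
  (perm w).apply_symm_apply a

lemma perm_neg_val (w : W n) (a : I n) : (perm w (-a)).1 = -(perm w a).1 :=
  congrArg Subtype.val (perm_neg w a)

lemma W.ext' {x y : W n} (h : ∀ a, perm x a = perm y a) : x = y :=
  Subtype.ext (Equiv.ext h)

lemma perm_inj (w : W n) {a b : I n} : perm w a = perm w b ↔ a = b := (perm w).injective.eq_iff

lemma perm_val_ne (w : W n) {a b : I n} (h : a.1 ≠ b.1) : (perm w a).1 ≠ (perm w b).1 := by
  intro h'
  exact h (congrArg Subtype.val ((perm_inj w).1 (I.ext' h')))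

/-- The map exchanging `a` with `b` and `-a` with `-b`. -/
def swFun (a b c : I n) : I n :=
  if c = a then b else if c = b then a else if c = -a then -b else if c = -b then -a else c

lemma swFun_val (a b c : I n) : (swFun a b c).1 =
    if c.1 = a.1 then b.1 else if c.1 = b.1 then a.1 else if c.1 = -a.1 then -b.1
      else if c.1 = -b.1 then -a.1 else c.1 := by
  have e : ∀ c d : I n, c = d ↔ c.1 = d.1 := fun c d => ⟨fun h => h ▸ rfl, I.ext'⟩
  unfold swFun
  simp only [e, val_neg]
  split_ifs <;> rfl

/-- The reflection exchanging `a` with `b` and `-a` with `-b`; it is `(a, -a)` if `b = -a`. -/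
def sw (a b : I n) : W n :=
  ⟨Function.Involutive.toPerm (swFun a b) (by
    intro c
    apply I.ext'
    have := val_ne_zero a
    have := val_ne_zero b
    rw [swFun_val, swFun_val]
    split_ifs <;> omega), by
    intro c
    apply I.ext'
    change (swFun a b (-c)).1 = -(swFun a b c).1
    have := val_ne_zero a
    have := val_ne_zero b
    rw [swFun_val, swFun_val, val_neg]
    split_ifs <;> omega⟩

lemma perm_sw (a b c : I n) : perm (sw a b) c = swFun a b c := rfl

lemma sw_apply (a b c : I n) : (perm (sw a b) c).1 =
    if c.1 = a.1 then b.1 else if c.1 = b.1 then a.1 else if c.1 = -a.1 then -b.1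
      else if c.1 = -b.1 then -a.1 else c.1 := swFun_val a b c

lemma sw_left (a b : I n) : perm (sw a b) a = b := by
  rw [perm_sw]; simp [swFun]

lemma sw_sw (a b c : I n) : perm (sw a b) (perm (sw a b) c) = c :=
  (perm (sw a b)).left_inv c

lemma sw_mul_self (a b : I n) : sw a b * sw a b = 1 := W.ext' fun c => sw_sw a b c

lemma sw_eq_or (a b c : I n) : perm (sw a b) c = c ∨ (c = a ∧ perm (sw a b) c = b) ∨
    (c = b ∧ perm (sw a b) c = a) ∨ (c = -a ∧ perm (sw a b) c = -b) ∨
    (c = -b ∧ perm (sw a b) c = -a) := by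
  rw [perm_sw]; unfold swFun
  split_ifs <;> simp_all

lemma mul_sw (u : W n) (a b : I n) : u * sw a b = sw (perm u a) (perm u b) * u := by
  apply W.ext'
  intro c
  rw [perm_mul, perm_mul, perm_sw, perm_sw]
  unfold swFun
  simp only [← perm_neg, perm_inj]
  split_ifs <;> rfl

lemma sw_neg_eq (a : I n) : perm (sw a (-a)) = Equiv.swap a (-a) := by
  ext c : 1
  rw [perm_sw, Equiv.swap_apply_def]
  unfold swFun
  split_ifs <;> simp_all

lemma sw_eq_mul {a b : I n} (h : a.1 ≠ -b.1) :
    perm (sw a b) = Equiv.swap a b * Equiv.swap (-a) (-b) := by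
  ext c : 1
  have e : ∀ c d : I n, c = d ↔ c.1 = d.1 := fun c d => ⟨fun h => h ▸ rfl, I.ext'⟩
  have := val_ne_zero a
  have := val_ne_zero b
  rw [Equiv.Perm.mul_apply, perm_sw, Equiv.swap_apply_def, Equiv.swap_apply_def]
  unfold swFun
  simp only [e, val_neg]
  split_ifs <;> simp only [e, val_neg] at * <;> omega

lemma perm_injective {x y : W n} (h : perm x = perm y) : x = y := Subtype.ext h

/-- The elements of `S_n` are the reflections exchanging neighbours. -/
lemma mem_S_iff {s : W n} : s ∈ S n ↔
    ∃ a b : I n, s = sw a b ∧ ((a.1 = 1 ∧ b = -a) ∨ (1 ≤ a.1 ∧ b.1 = a.1 + 1)) := by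
  constructor
  · rintro (⟨a, ha, hs⟩ | ⟨k, hk, a, b, ha, hb, hs⟩)
    · exact ⟨a, -a, perm_injective (by rw [hs, sw_neg_eq]), .inl ⟨ha, rfl⟩⟩
    · exact ⟨a, b, perm_injective (by rw [hs, sw_eq_mul (by omega)]), .inr ⟨by omega, by omega⟩⟩
  · rintro ⟨a, b, rfl, ⟨ha, rfl⟩ | ⟨ha, hb⟩⟩
    · exact .inl ⟨a, ha, sw_neg_eq a⟩
    · exact .inr ⟨a.1, ha, a, b, rfl, hb, sw_eq_mul (by omega)⟩

lemma sw_comm (a b : I n) : sw a b = sw b a := by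
  apply W.ext'
  intro c
  apply I.ext'
  have := val_ne_zero a
  have := val_ne_zero b
  rw [sw_apply, sw_apply]
  split_ifs <;> omega

lemma sw_neg_neg (a b : I n) : sw (-a) (-b) = sw a b := by
  apply W.ext'
  intro c
  apply I.ext'
  have := val_ne_zero a
  have := val_ne_zero b
  rw [sw_apply, sw_apply]
  simp only [val_neg]
  split_ifs <;> omega

/-- A simple reflection that reverses the order of `p < q` is the reflection exchanging them. -/
lemma eq_sw_of_mem_S {s : W n} (hs : s ∈ S n) {p q : I n} (hpq : p.1 < q.1)
    (h : (perm s q).1 < (perm s p).1) : s = sw p q := by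
  have hp := val_ne_zero p
  have hq := val_ne_zero q
  obtain ⟨a, b, rfl, ⟨ha, rfl⟩ | ⟨ha, hb⟩⟩ := mem_S_iff.1 hs
  · rw [sw_apply, sw_apply, val_neg, ha] at h
    have : p.1 = -1 ∧ q.1 = 1 := by split_ifs at h <;> omega
    rw [sw_comm, I.ext' (this.2.trans ha.symm), I.ext' (this.1.trans (by rw [val_neg, ha]))]
  · rw [sw_apply, sw_apply, hb] at h
    have : (p.1 = a.1 ∧ q.1 = a.1 + 1) ∨ (p.1 = -(a.1 + 1) ∧ q.1 = -a.1) := by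
      split_ifs at h <;> omega
    rcases this with ⟨h1, h2⟩ | ⟨h1, h2⟩
    · rw [I.ext' h1, I.ext' (h2.trans hb.symm)]
    · rw [sw_comm p q, ← sw_neg_neg a b, I.ext' (a := p) (b := -b) (by rw [h1, val_neg, hb]),
        I.ext' (a := q) (b := -a) h2]

/-- If `w` reverses the order of some pair, then it reverses the order of a pair exchanged by a
simple reflection. -/
lemma exists_simple_descent (w : W n) {a b : I n} (hab : a.1 < b.1)
    (h : (perm w b).1 < (perm w a).1) :
    ∃ s ∈ S n, ∃ p q : I n, p.1 < q.1 ∧ (perm w q).1 < (perm w p).1 ∧ s = sw p q := by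
  by_contra hcon
  push Not at hcon
  have key : ∀ m : ℕ, ∀ a b : I n, a.1 < b.1 → (b.1 - a.1).toNat = m →
      (perm w a).1 < (perm w b).1 := by
    intro m
    induction m using Nat.strong_induction_on with
    | _ m ih =>
      intro a b hab hm
      have ha0 := val_ne_zero a
      have hb0 := val_ne_zero b
      have hal := val_le a
      have hbl := val_le b
      have hal' := neg_le_val a
      have hbl' := neg_le_val b
      by_cases hadj : ∃ c : I n, a.1 < c.1 ∧ c.1 < b.1
      · obtain ⟨c, h1, h2⟩ := hadj
        exact (ih _ (by omega) a c h1 rfl).trans (ih _ (by omega) c b h2 rfl)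
      · by_contra hlt
        have hlt' : (perm w b).1 < (perm w a).1 := by
          have := perm_val_ne w (a := a) (b := b) (by omega)
          omega
        refine hcon (sw a b) ?_ a b hab hlt' rfl
        push Not at hadj
        rw [mem_S_iff]
        by_cases h1 : a.1 = -1
        · have hb1 : b.1 = 1 := by
            by_contra hne
            have := hadj (mkPos 1 le_rfl (by omega)) (by rw [mkPos_val]; omega)
            rw [mkPos_val] at this
            omega
          exact ⟨b, a, sw_comm _ _, .inl ⟨hb1, I.ext' (by rw [val_neg]; omega)⟩⟩
        · have hb : b.1 = a.1 + 1 := by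
            by_contra hne
            have := hadj ⟨a.1 + 1, by omega, by rw [abs_le]; omega⟩
              (by change a.1 < a.1 + 1; omega)
            change b.1 ≤ a.1 + 1 at this
            omega
          rcases lt_or_gt_of_ne ha0 with h0 | h0
          · exact ⟨-b, -a, by rw [sw_neg_neg, sw_comm],
              .inr ⟨by rw [val_neg]; omega, by rw [val_neg, val_neg]; omega⟩⟩
          · exact ⟨a, b, rfl, .inr ⟨by omega, hb⟩⟩
  have := key _ a b hab rfl
  omega

instance : Fintype (I n) := Fintype.ofFinite _

/-- The pairing of an integral function `κ` with the one-line notation of `w`. -/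
def pairing (κ : I n → ℤ) (w : W n) : ℤ := ∑ c : I n, κ c * (perm w c).1

/-- Removing an inversion with respect to `κ` increases the pairing. -/
lemma pairing_lt (κ : I n → ℤ) (hκ : ∀ a, κ (-a) = -κ a) (w : W n) {a b : I n}
    (hab : κ a < κ b) (h : (perm w b).1 < (perm w a).1) :
    pairing κ w < pairing κ (w * sw a b) := by
  set s := perm (sw a b) with hs
  have h1 : pairing κ (w * sw a b) = ∑ c, κ (s c) * (perm w c).1 := by
    unfold pairing
    rw [← Equiv.sum_comp s]
    refine Finset.sum_congr rfl fun c _ => ?_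
    rw [perm_mul, hs, sw_sw]
  have h2 : pairing κ w = ∑ c, κ (s c) * (perm w (s c)).1 := by
    unfold pairing
    rw [← Equiv.sum_comp s]
  have h3 : pairing κ (w * sw a b) = ∑ c, κ c * (perm w (s c)).1 := rfl
  -- twice the difference is a sum of nonnegative terms, and the term at `a` is positive
  have h4 : 0 < ∑ c, (κ (s c) - κ c) * ((perm w c).1 - (perm w (s c)).1) := by
    apply Finset.sum_pos'
    · intro c _
      have e1 := perm_neg_val w a
      have e2 := perm_neg_val w b
      rcases sw_eq_or a b c with h | ⟨rfl, h⟩ | ⟨rfl, h⟩ | ⟨rfl, h⟩ | ⟨rfl, h⟩ <;> rw [hs, h]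
      · simp
      · nlinarith
      · nlinarith
      · rw [e1, e2, hκ, hκ]; nlinarith
      · rw [e1, e2, hκ, hκ]; nlinarith
    · refine ⟨a, Finset.mem_univ _, ?_⟩
      rw [hs, sw_left]
      nlinarith
  have h5 : ∑ c, (κ (s c) - κ c) * ((perm w c).1 - (perm w (s c)).1)
      = ((∑ c, κ (s c) * (perm w c).1) + ∑ c, κ c * (perm w (s c)).1)
        - ((∑ c, κ (s c) * (perm w (s c)).1) + ∑ c, κ c * (perm w c).1) := by
    rw [← Finset.sum_add_distrib, ← Finset.sum_add_distrib, ← Finset.sum_sub_distrib]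
    exact Finset.sum_congr rfl fun c _ => by ring
  rw [h5, ← h1, ← h2, ← h3] at h4
  change 0 < _ - (_ + pairing κ w) at h4
  omega

/-- Every odd integral function on `{±1, …, ±n}` is sorted by some signed permutation. -/
lemma exists_sorting (κ : I n → ℤ) (hκ : ∀ a, κ (-a) = -κ a) :
    ∃ w : W n, ∀ a b, κ a < κ b → (perm w a).1 < (perm w b).1 := by
  obtain ⟨w, -, hw⟩ := Finset.exists_max_image Finset.univ (pairing κ) ⟨(1 : W n), Finset.mem_univ _⟩
  refine ⟨w, fun a b hab => ?_⟩
  by_contra hlt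
  have hne : (perm w a).1 ≠ (perm w b).1 := perm_val_ne w fun h => by
    rw [I.ext' h] at hab; omega
  have := pairing_lt κ hκ w hab (by omega)
  have := hw (w * sw a b) (Finset.mem_univ _)
  omega

/-! ### Block relations, their stabilizers and their distinguished coset representatives -/

/-- An equivalence relation on `{±1, …, ±n}` that is compatible with negation. Relations are ordered
by refinement: `r ≤ s` means that the classes of `s` are unions of classes of `r`. -/
structure BlockRel (n : ℕ) where
  rel : I n → I n → Prop
  refl : ∀ a, rel a a
  symm : ∀ {a b}, rel a b → rel b a
  trans : ∀ {a b c}, rel a b → rel b c → rel a c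
  neg : ∀ {a b}, rel a b → rel (-a) (-b)

namespace BlockRel

variable {r s : BlockRel n}

lemma ext' (h : ∀ a b, r.rel a b ↔ s.rel a b) : r = s := by
  obtain ⟨r, _, _, _, _⟩ := r
  obtain ⟨s, _, _, _, _⟩ := s
  congr 1
  ext a b
  exact h a b

instance : LE (BlockRel n) := ⟨fun r s => ∀ a b, r.rel a b → s.rel a b⟩

/-- The relation with a single class. -/
instance : Top (BlockRel n) := ⟨⟨fun _ _ => True, fun _ => trivial, fun _ => trivial,
  fun _ _ => trivial, fun _ => trivial⟩⟩

instance : Min (BlockRel n) := ⟨fun r s => ⟨fun a b => r.rel a b ∧ s.rel a b,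
  fun a => ⟨r.refl a, s.refl a⟩, fun h => ⟨r.symm h.1, s.symm h.2⟩,
  fun h h' => ⟨r.trans h.1 h'.1, s.trans h.2 h'.2⟩, fun h => ⟨r.neg h.1, s.neg h.2⟩⟩⟩

/-- The inverse image of a relation under a signed permutation. -/
def pull (r : BlockRel n) (d : W n) : BlockRel n :=
  ⟨fun a b => r.rel (perm d a) (perm d b), fun _ => r.refl _, fun h => r.symm h,
    fun h h' => r.trans h h', fun h => by simpa using r.neg h⟩

lemma le_top' (r : BlockRel n) : r ≤ ⊤ := fun _ _ _ => trivial

lemma le_rfl' (r : BlockRel n) : r ≤ r := fun _ _ h => h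

lemma le_trans' {r s t : BlockRel n} (h : r ≤ s) (h' : s ≤ t) : r ≤ t :=
  fun a b hab => h' a b (h a b hab)

lemma inf_le_right' (r s : BlockRel n) : r ⊓ s ≤ s := fun _ _ h => h.2

lemma neg_iff (r : BlockRel n) {a b : I n} : r.rel (-a) (-b) ↔ r.rel a b :=
  ⟨fun h => by simpa using r.neg h, r.neg⟩

/-- The signed permutations that preserve every class. -/
def stab (r : BlockRel n) : Subgroup (W n) where
  carrier := {w | ∀ a, r.rel (perm w a) a}
  one_mem' := fun a => r.refl a
  mul_mem' := fun {x y} hx hy a => r.trans (hx (perm y a)) (hy a)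
  inv_mem' := fun {x} hx a => by
    have := hx (perm x⁻¹ a)
    rw [perm_perm_inv] at this
    exact r.symm this

/-- The signed permutations that are increasing on every class. -/
def incr (r : BlockRel n) : Set (W n) :=
  {x | ∀ a b, r.rel a b → a.1 < b.1 → (perm x a).1 < (perm x b).1}

lemma mem_incr {x : W n} :
    x ∈ r.incr ↔ ∀ a b, r.rel a b → a.1 < b.1 → (perm x a).1 < (perm x b).1 := Iff.rfl

lemma incr_lt_iff {x : W n} (hx : x ∈ r.incr) {a b : I n} (h : r.rel a b) :
    (perm x a).1 < (perm x b).1 ↔ a.1 < b.1 := by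
  refine ⟨fun hlt => ?_, hx a b h⟩
  by_contra hge
  rcases eq_or_lt_of_le (not_lt.1 hge) with he | hl
  · rw [I.ext' he] at hlt
    omega
  · have := hx b a (r.symm h) hl
    omega

@[simp] lemma mem_stab_top (w : W n) : w ∈ (⊤ : BlockRel n).stab := fun _ => trivial

@[simp] lemma stab_top : (⊤ : BlockRel n).stab = ⊤ :=
  (Subgroup.eq_top_iff' _).2 mem_stab_top

lemma sw_mem_stab {a b : I n} (h : r.rel a b) : sw a b ∈ r.stab := by
  intro c
  rcases sw_eq_or a b c with h' | ⟨rfl, h'⟩ | ⟨rfl, h'⟩ | ⟨rfl, h'⟩ | ⟨rfl, h'⟩ <;> rw [h']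
  · exact r.refl _
  · exact r.symm h
  · exact h
  · exact r.symm (r.neg h)
  · exact r.neg h

/-- The stabilizer determines the relation: related elements are exchanged by a reflection in it. -/
lemma stab_le_iff : r.stab ≤ s.stab ↔ r ≤ s := by
  refine ⟨fun h a b hab => ?_, fun h w hw a => h _ _ (hw a)⟩
  have := h (sw_mem_stab hab) a
  rw [sw_left] at this
  exact s.symm this

lemma stab_injective (h : r.stab = s.stab) : r = s :=
  ext' fun a b => ⟨fun h' => stab_le_iff.1 h.le a b h', fun h' => stab_le_iff.1 h.ge a b h'⟩

lemma stab_inf : (r ⊓ s).stab = r.stab ⊓ s.stab := by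
  ext w
  exact ⟨fun h => ⟨fun a => (h a).1, fun a => (h a).2⟩, fun h a => ⟨h.1 a, h.2 a⟩⟩

lemma mem_stab_pull {d w : W n} : w ∈ (r.pull d).stab ↔ d * w * d⁻¹ ∈ r.stab := by
  refine ⟨fun h a => ?_, fun h a => ?_⟩
  · have := h (perm d⁻¹ a)
    change r.rel (perm d _) (perm d _) at this
    rw [perm_perm_inv] at this
    exact this
  · have := h (perm d a)
    rw [perm_mul, perm_inv_perm] at this
    exact this

lemma stab_pull (d : W n) : (r.pull d).stab = r.stab.map (MulAut.conj d⁻¹).toMonoidHom := by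
  ext w
  rw [mem_stab_pull, Subgroup.mem_map]
  refine ⟨fun h => ⟨_, h, ?_⟩, ?_⟩
  · simp [mul_assoc]
  · rintro ⟨x, hx, rfl⟩
    simpa [mul_assoc] using hx

/-- A nontrivial element preserving every class cannot increase on every class: consider the least
point that it moves. -/
lemma eq_one_of_mem {w : W n} (hw : w ∈ r.stab) (hx : w ∈ r.incr) : w = 1 := by
  by_contra hne
  have hne' : {a : I n | perm w a ≠ a}.Nonempty := by
    by_contra hemp
    rw [Set.not_nonempty_iff_eq_empty, Set.eq_empty_iff_forall_notMem] at hemp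
    exact hne (W.ext' fun a => not_not.1 (hemp a))
  obtain ⟨a, ha, hmin⟩ := Set.exists_min_image _ (fun a : I n => a.1) (Set.toFinite _) hne'
  have hmin' : ∀ b : I n, b.1 < a.1 → perm w b = b := fun b hb => by
    by_contra h
    have := hmin b h
    omega
  rcases lt_or_gt_of_ne (val_ne_of_ne ha) with h | h
  · exact ha ((perm_inj w).1 (hmin' _ h))
  · have hb : r.rel a (perm w⁻¹ a) := r.symm (r.stab.inv_mem hw a)
    rcases lt_trichotomy (perm w⁻¹ a).1 a.1 with h' | h' | h'
    · have := hmin' _ h'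
      rw [perm_perm_inv] at this
      rw [← this] at h'
      omega
    · have h2 := I.ext' h'
      apply ha
      conv_lhs => rw [← h2]
      exact perm_perm_inv w a
    · have := hx _ _ hb h'
      rw [perm_perm_inv] at this
      omega

/-- A coset of `W_r` contains at most one element that is increasing on the classes. -/
lemma mul_mem_incr_iff {x w : W n} (hx : x ∈ r.incr) (hw : w ∈ r.stab) :
    x * w ∈ r.incr ↔ w = 1 := by
  refine ⟨fun h => eq_one_of_mem hw fun a b hab hlt => ?_, fun h => by rw [h, mul_one]; exact hx⟩
  have h1 : r.rel (perm w a) (perm w b) := r.trans (hw a) (r.trans hab (r.symm (hw b)))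
  exact (incr_lt_iff hx h1).1 (h a b hab hlt)

end BlockRel

/-! ### Length -/

/-- `S_n` generates `W_n`. -/
lemma closure_S : Subgroup.closure (S n) = ⊤ := by
  rw [Subgroup.eq_top_iff']
  by_contra hcon
  push Not at hcon
  obtain ⟨x, hx⟩ := hcon
  -- outside the generated subgroup, an element closest to being sorted would be sorted
  obtain ⟨w, hw, hmax⟩ := Finset.exists_max_image
    (Finset.univ.filter fun w : W n => w ∉ Subgroup.closure (S n)) (pairing fun a => a.1)
    ⟨x, by simpa using hx⟩
  rw [Finset.mem_filter] at hw
  have hne : w ∉ (⊤ : BlockRel n).incr := fun h => hw.2 (by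
    rw [BlockRel.eq_one_of_mem (BlockRel.mem_stab_top w) h]; exact one_mem _)
  rw [BlockRel.mem_incr] at hne
  push Not at hne
  obtain ⟨a, b, -, hab, hle⟩ := hne
  have hlt : (perm w b).1 < (perm w a).1 :=
    lt_of_le_of_ne hle (perm_val_ne w (by omega))
  obtain ⟨s, hs, p, q, hpq, hlt', rfl⟩ := exists_simple_descent w hab hlt
  have h1 := pairing_lt (fun a => a.1) (fun _ => rfl) w hpq hlt'
  have h2 := hmax (w * sw p q) (by
    rw [Finset.mem_filter]
    refine ⟨Finset.mem_univ _, fun h => hw.2 ?_⟩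
    have := mul_mem h (Subgroup.subset_closure hs)
    rwa [mul_assoc, sw_mul_self, mul_one] at this)
  omega

lemma exists_word (w : W n) : ∃ l : List (W n), (∀ s ∈ l, s ∈ S n) ∧ l.prod = w := by
  have h : w ∈ Subgroup.closure (S n) := by rw [closure_S]; trivial
  rw [← Subgroup.mem_toSubmonoid, Subgroup.closure_toSubmonoid_of_finite] at h
  obtain ⟨l, hl, hw⟩ := Submonoid.exists_list_of_mem_closure h
  exact ⟨l, hl, hw⟩

lemma exists_word_length (w : W n) :
    ∃ l : List (W n), (∀ s ∈ l, s ∈ S n) ∧ l.prod = w ∧ l.length = len w := by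
  obtain ⟨l, hl, hw⟩ := exists_word w
  exact Nat.sInf_mem (s := {k | ∃ l : List (W n), (∀ s ∈ l, s ∈ S n) ∧ l.prod = w ∧ l.length = k})
    ⟨l.length, l, hl, hw, rfl⟩

/-- The strong exchange property: if the product `x` of a word reverses the order of `a < b`,
then deleting the letter at which the order of the images changes gives a word for `x * sw a b`. -/
lemma exists_shorter_word (l : List (W n)) (hl : ∀ s ∈ l, s ∈ S n) {a b : I n} (hab : a.1 < b.1)
    (h : (perm l.prod b).1 < (perm l.prod a).1) :
    ∃ l' : List (W n), (∀ s ∈ l', s ∈ S n) ∧ l'.prod = l.prod * sw a b ∧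
      l'.length < l.length := by
  induction l with
  | nil =>
    simp only [List.prod_nil, perm_one] at h
    omega
  | cons s l ih =>
    have hs : s ∈ S n := hl s (by simp)
    have hl' : ∀ s ∈ l, s ∈ S n := fun t ht => hl t (by simp [ht])
    rcases lt_or_gt_of_ne (perm_val_ne l.prod (a := a) (b := b) (by omega)) with h1 | h1
    · have := eq_sw_of_mem_S hs h1 (by rw [List.prod_cons] at h; exact h)
      refine ⟨l, hl', ?_, by simp⟩
      rw [List.prod_cons, mul_assoc, mul_sw, this, ← mul_assoc, sw_mul_self, one_mul]
    · obtain ⟨l', h2, h3, h4⟩ := ih hl' h1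
      refine ⟨s :: l', ?_, ?_, by simpa using h4⟩
      · intro t ht
        rcases List.mem_cons.1 ht with rfl | ht
        · exact hs
        · exact h2 t ht
      · rw [List.prod_cons, List.prod_cons, h3, mul_assoc]

lemma len_mul_sw_lt (x : W n) {a b : I n} (hab : a.1 < b.1)
    (h : (perm x b).1 < (perm x a).1) : len (x * sw a b) < len x := by
  obtain ⟨l, hl, rfl, hlen⟩ := exists_word_length x
  obtain ⟨l', h1, h2, h3⟩ := exists_shorter_word l hl hab h
  rw [← hlen]
  exact lt_of_le_of_lt (Nat.sInf_le ⟨l', h1, h2, rfl⟩) h3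

namespace BlockRel

variable {r s : BlockRel n}

/-- Elements of minimal length in their coset of `W_r` are increasing on the classes. -/
lemma mem_incr_of_len_le {x : W n} (h : ∀ w ∈ r.stab, len x ≤ len (x * w)) : x ∈ r.incr := by
  intro a b hab hlt
  by_contra hge
  have hlt' : (perm x b).1 < (perm x a).1 :=
    lt_of_le_of_ne (not_lt.1 hge) (perm_val_ne x (by omega))
  have h1 := h _ (sw_mem_stab hab)
  have h2 := len_mul_sw_lt x hlt hlt'
  omega

lemma exists_mul_mem_incr (r : BlockRel n) (x : W n) : ∃ w ∈ r.stab, x * w ∈ r.incr := by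
  obtain ⟨w, hw, hmin⟩ := Set.exists_min_image (r.stab : Set (W n)) (fun w => len (x * w))
    (Set.toFinite _) ⟨1, one_mem _⟩
  refine ⟨w, hw, mem_incr_of_len_le fun v hv => ?_⟩
  rw [mul_assoc]
  exact hmin _ (mul_mem hw hv)

/-- The elements that are increasing on the classes are those of minimal length in their coset. -/
lemma mem_incr_iff_len_le {x : W n} : x ∈ r.incr ↔ ∀ w ∈ r.stab, len x ≤ len (x * w) := by
  refine ⟨fun hx w hw => ?_, mem_incr_of_len_le⟩
  obtain ⟨v, hv, hmin⟩ := Set.exists_min_image (r.stab : Set (W n)) (fun w => len (x * w))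
    (Set.toFinite _) ⟨1, one_mem _⟩
  have : x * v ∈ r.incr := mem_incr_of_len_le fun u hu => by
    rw [mul_assoc]
    exact hmin _ (mul_mem hv hu)
  rw [mul_mem_incr_iff hx hv] at this
  subst this
  simpa using hmin w hw

/-- The representative of `W_r y` whose inverse is increasing on the classes of `r`. -/
lemma exists_left_rep (r : BlockRel n) (y : W n) : ∃ d, d⁻¹ ∈ r.incr ∧ y * d⁻¹ ∈ r.stab := by
  obtain ⟨w, hw, h⟩ := r.exists_mul_mem_incr y⁻¹
  exact ⟨w⁻¹ * y, by simpa using h, by simpa using hw⟩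

lemma left_rep_unique {d d' : W n} (hd : d⁻¹ ∈ r.incr) (hd' : d'⁻¹ ∈ r.incr)
    (h : d' * d⁻¹ ∈ r.stab) : d = d' := by
  have h1 : d⁻¹ * (d * d'⁻¹) ∈ r.incr := by simpa using hd'
  have h2 : d * d'⁻¹ ∈ r.stab := by simpa using r.stab.inv_mem h
  exact mul_inv_eq_one.1 ((mul_mem_incr_iff hd h2).1 h1)

end BlockRel

/-! ### Interval relations -/

namespace BlockRel

variable {r C D E G : BlockRel n}

/-- The relations attached to signed compositions: the classes meet the positive integers in
intervals, and a class containing integers of both signs is symmetric. -/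
structure IsInterval (r : BlockRel n) : Prop where
  convex : ∀ {a b c : I n}, 0 < a.1 → a.1 < b.1 → b.1 < c.1 → r.rel a c → r.rel a b
  symmetric : ∀ {a b : I n}, a.1 < 0 → 0 < b.1 → r.rel a b → r.rel a (-a)

/-- Every class with at least two positive elements is symmetric. -/
def SemiPos (r : BlockRel n) : Prop :=
  ∀ a b : I n, 0 < a.1 → a.1 < b.1 → r.rel a b → r.rel a (-a)

lemma isInterval_top : (⊤ : BlockRel n).IsInterval := ⟨fun _ _ _ _ => trivial, fun _ _ _ => trivial⟩

lemma rel_neg_self_of_rel {a b : I n} (h : r.rel a (-a)) (hab : r.rel a b) : r.rel b (-b) :=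
  r.trans (r.symm hab) (r.trans h (r.neg hab))

lemma IsInterval.symmetric' (hr : r.IsInterval) {a b : I n} (ha : a.1 < 0) (hb : 0 < b.1)
    (h : r.rel a b) : r.rel b (-b) := rel_neg_self_of_rel (hr.symmetric ha hb h) h

/-- Distinct classes cannot cross on the positive integers. -/
lemma IsInterval.rel_of_cross (hr : r.IsInterval) {p q p' q' : I n} (hp : 0 < p.1) (hq' : 0 < q'.1)
    (h : p.1 < q.1) (h' : q'.1 < p'.1) (hpp : r.rel p p')
    (hqq : r.rel q q') : r.rel p q := by
  rcases lt_trichotomy p.1 q'.1 with h1 | h1 | h1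
  · exact r.trans (hr.convex hp h1 h' hpp) (r.symm hqq)
  · rw [I.ext' h1]; exact r.symm hqq
  · exact r.trans (r.symm (hr.convex hq' h1 h (r.symm hqq))) (r.symm hqq)

lemma IsInterval.rel_neg_self (hr : r.IsInterval) (hs : r.SemiPos) {a b : I n} (hab : a.1 < b.1)
    (h : r.rel a b) : r.rel a (-a) := by
  have ha := val_ne_zero a
  have hb := val_ne_zero b
  by_cases h1 : 0 < a.1
  · exact hs a b h1 hab h
  by_cases h2 : 0 < b.1
  · exact hr.symmetric (by omega) h2 h
  · have := hs (-b) (-a) (by rw [val_neg]; omega) (by rw [val_neg, val_neg]; omega)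
      (r.neg (r.symm h))
    exact rel_neg_self_of_rel (r.neg_iff.1 this) (r.symm h)

lemma incr_pos_iff {x : W n} (hx : x ∈ r.incr) {a : I n} (h : r.rel a (-a)) :
    0 < (perm x a).1 ↔ 0 < a.1 := by
  have := incr_lt_iff hx (r.symm h)
  rw [perm_neg_val, val_neg] at this
  omega

lemma rel_of_mul_inv_mem {y d : W n} (h : y * d⁻¹ ∈ r.stab) (a : I n) :
    r.rel (perm y a) (perm d a) := by
  have := h (perm d a)
  rwa [perm_mul, perm_inv_perm] at this

/-- The relation of `d⁻¹C ∩ D` comes from a signed composition when `D` is semi-positive. -/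
lemma isInterval_pull_inf (hC : C.IsInterval) (hD : D.IsInterval) (hs : D.SemiPos) {d : W n}
    (hd : d ∈ D.incr) : (C.pull d ⊓ D).IsInterval := by
  constructor
  · rintro a b c ha hab hbc ⟨h1, h2⟩
    have h3 := hD.convex ha hab hbc h2
    have h4 := hs a b ha hab h3
    exact ⟨hC.convex ((incr_pos_iff hd h4).2 ha) (hd _ _ h3 hab)
      (hd _ _ (D.trans (D.symm h3) h2) hbc) h1, h3⟩
  · rintro a b ha hb ⟨h1, h2⟩
    have h3 := hD.symmetric ha hb h2
    have h4 := hD.symmetric' ha hb h2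
    have h5 := (incr_pos_iff hd h4).2 hb
    have h6 := incr_pos_iff hd h3
    have h7 := val_ne_zero (perm d a)
    refine ⟨?_, h3⟩
    have := hC.symmetric (by omega) h5 h1
    rwa [← perm_neg] at this

/-! ### Products of sums of coset representatives -/

/-- For a semi-positive `D`, passing from `y ∈ X_D` to the representative of `W_C y` preserves
membership in `X_D`. -/
lemma left_rep_mem_incr (hC : C.IsInterval) (hD : D.IsInterval) (hs : D.SemiPos) {y d : W n}
    (hy : y ∈ D.incr) (hd : d⁻¹ ∈ C.incr) (h : y * d⁻¹ ∈ C.stab) : d ∈ D.incr := by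
  have hrel := rel_of_mul_inv_mem h
  have hlt : ∀ {a b : I n}, C.rel (perm d a) (perm d b) → (perm d a).1 < (perm d b).1 →
      a.1 < b.1 := fun {a b} h1 h2 => by
    have := hd _ _ h1 h2
    rwa [perm_inv_perm, perm_inv_perm] at this
  have hpos : ∀ a : I n, D.rel a (-a) → 0 < a.1 → 0 < (perm d a).1 := by
    intro a h1 h2
    by_contra h3
    have h3' : (perm d a).1 < 0 := lt_of_le_of_ne (not_lt.1 h3) (val_ne_zero _)
    have h4 := hC.symmetric h3' ((incr_pos_iff hy h1).2 h2) (C.symm (hrel a))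
    rw [← perm_neg] at h4
    have := hlt h4 (by rw [perm_neg_val]; omega)
    rw [val_neg] at this
    omega
  have key : ∀ a b : I n, D.rel a b → 0 < a.1 → a.1 < b.1 → (perm d a).1 < (perm d b).1 := by
    intro a b hab ha hlt'
    have h1 := hD.rel_neg_self hs hlt' hab
    have h2 := rel_neg_self_of_rel h1 hab
    by_contra hge
    have h3 : (perm d b).1 < (perm d a).1 :=
      lt_of_le_of_ne (not_lt.1 hge) (perm_val_ne d (by omega))
    have h4 := hC.rel_of_cross ((incr_pos_iff hy h1).2 ha) (hpos b h2 (by omega))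
      (hy a b hab hlt') h3 (hrel a) (hrel b)
    have := hlt (C.trans (C.symm (hrel b)) (C.trans (C.symm h4) (hrel a))) h3
    omega
  intro a b hab hlt'
  have ha := val_ne_zero a
  have hb := val_ne_zero b
  have h1 := hD.rel_neg_self hs hlt' hab
  by_cases h3 : 0 < a.1
  · exact key a b hab h3 hlt'
  by_cases h4 : 0 < b.1
  · have h5 := hpos b (rel_neg_self_of_rel h1 hab) h4
    have h6 := hpos (-a) (D.neg h1) (by rw [val_neg]; omega)
    rw [perm_neg_val] at h6
    omega
  · have := key (-b) (-a) (D.neg (D.symm hab)) (by rw [val_neg]; omega)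
      (by rw [val_neg, val_neg]; omega)
    rw [perm_neg_val, perm_neg_val] at this
    omega

/-- For a semi-positive `D`, whether `y ∈ W_C d` is in `X_D` can be read off from `u y` for
any `u ∈ X_C`. -/
lemma mem_incr_iff_mul_mem (hC : C.IsInterval) (hD : D.IsInterval) (hs : D.SemiPos) {u y d : W n}
    (hu : u ∈ C.incr) (hd : d ∈ D.incr) (h : y * d⁻¹ ∈ C.stab) :
    y ∈ D.incr ↔ u * y ∈ (C.pull d ⊓ D).incr := by
  have hrel := rel_of_mul_inv_mem h
  have hyd : ∀ a b, C.rel (perm d a) (perm d b) → C.rel (perm y a) (perm y b) := fun a b hab =>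
    C.trans (hrel a) (C.trans hab (C.symm (hrel b)))
  refine ⟨fun hy a b hab hlt => hu _ _ (hyd a b hab.1) (hy _ _ hab.2 hlt), fun hw => ?_⟩
  have hlt : ∀ a b, D.rel a b → C.rel (perm d a) (perm d b) → a.1 < b.1 →
      (perm y a).1 < (perm y b).1 := fun a b h1 h2 h3 =>
    (incr_lt_iff hu (hyd a b h2)).1 (hw a b ⟨h2, h1⟩ h3)
  have hpos : ∀ a : I n, D.rel a (-a) → 0 < a.1 → 0 < (perm y a).1 := by
    intro a h1 h2
    have hda := (incr_pos_iff hd h1).2 h2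
    by_contra h3
    have h3' : (perm y a).1 < 0 := lt_of_le_of_ne (not_lt.1 h3) (val_ne_zero _)
    have h4 := hC.symmetric' h3' hda (hrel a)
    rw [← perm_neg] at h4
    have := hlt (-a) a (D.symm h1) (C.symm h4) (by rw [val_neg]; omega)
    rw [perm_neg_val] at this
    omega
  have key : ∀ a b : I n, D.rel a b → 0 < a.1 → a.1 < b.1 → (perm y a).1 < (perm y b).1 := by
    intro a b hab ha hlt'
    have h1 := hD.rel_neg_self hs hlt' hab
    have h2 := rel_neg_self_of_rel h1 hab
    by_contra hge
    have h3 : (perm y b).1 < (perm y a).1 :=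
      lt_of_le_of_ne (not_lt.1 hge) (perm_val_ne y (by omega))
    have h4 := hC.rel_of_cross ((incr_pos_iff hd h1).2 ha) (hpos b h2 (by omega))
      (hd a b hab hlt') h3 (C.symm (hrel a))
      (C.symm (hrel b))
    have := hlt a b hab h4 hlt'
    omega
  intro a b hab hlt'
  have ha := val_ne_zero a
  have hb := val_ne_zero b
  have h1 := hD.rel_neg_self hs hlt' hab
  by_cases h3 : 0 < a.1
  · exact key a b hab h3 hlt'
  by_cases h4 : 0 < b.1
  · have h5 := hpos b (rel_neg_self_of_rel h1 hab) h4
    have h6 := hpos (-a) (D.neg h1) (by rw [val_neg]; omega)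
    rw [perm_neg_val] at h6
    omega
  · have := key (-b) (-a) (D.neg (D.symm hab)) (by rw [val_neg]; omega)
      (by rw [val_neg, val_neg]; omega)
    rw [perm_neg_val, perm_neg_val] at this
    omega

/-- No class contains integers of both signs. -/
def Separated (r : BlockRel n) : Prop := ∀ a b : I n, r.rel a b → (0 < a.1 ↔ 0 < b.1)

lemma IsInterval.convex' (hE : E.IsInterval) (hs : E.Separated) {a b c : I n} (hab : a.1 < b.1)
    (hbc : b.1 < c.1) (h : E.rel a c) : E.rel a b := by
  have h0 := hs a c h
  have ha := val_ne_zero a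
  have hc := val_ne_zero c
  by_cases h1 : 0 < a.1
  · exact hE.convex h1 hab hbc h
  · have := hE.convex (a := -c) (b := -b) (c := -a) (by rw [val_neg]; omega)
      (by rw [val_neg, val_neg]; omega) (by rw [val_neg, val_neg]; omega) (E.neg (E.symm h))
    exact E.trans h (E.neg_iff.1 this)

lemma IsInterval.rel_of_cross' (hE : E.IsInterval) (hs : E.Separated) {p q p' q' : I n}
    (h : p.1 < q.1) (h' : q'.1 < p'.1) (hpp : E.rel p p') (hqq : E.rel q q') : E.rel p q := by
  rcases lt_trichotomy p.1 q'.1 with h1 | h1 | h1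
  · exact E.trans (hE.convex' hs h1 h' hpp) (E.symm hqq)
  · rw [I.ext' h1]; exact E.symm hqq
  · exact E.trans (E.symm (hE.convex' hs h1 h (E.symm hqq))) (E.symm hqq)

lemma isInterval_pull_inf_of_separated (hE : E.IsInterval) (hs : E.Separated) (hD : D.IsInterval)
    {d : W n} (hd : d ∈ D.incr) : (E.pull d ⊓ D).IsInterval := by
  constructor
  · rintro a b c ha hab hbc ⟨h1, h2⟩
    have h3 := hD.convex ha hab hbc h2
    exact ⟨hE.convex' hs (hd _ _ h3 hab) (hd _ _ (D.trans (D.symm h3) h2) hbc) h1, h3⟩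
  · rintro a b ha hb ⟨h1, h2⟩
    have h3 := incr_pos_iff hd (hD.symmetric ha hb h2)
    have h4 := incr_pos_iff hd (hD.symmetric' ha hb h2)
    have h5 := hs _ _ h1
    omega

/-- If no class of `E` contains integers of both signs, then `left_rep_mem_incr` holds for every
`D`: the classes of `E` are intervals of `{±1, …, ±n}`, hence do not cross. -/
lemma left_rep_mem_incr_of_separated (hE : E.IsInterval) (hs : E.Separated) {y d : W n}
    (hy : y ∈ D.incr) (hd : d⁻¹ ∈ E.incr) (h : y * d⁻¹ ∈ E.stab) : d ∈ D.incr := by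
  have hrel := rel_of_mul_inv_mem h
  intro a b hab hlt
  by_contra hge
  have h3 : (perm d b).1 < (perm d a).1 :=
    lt_of_le_of_ne (not_lt.1 hge) (perm_val_ne d (by omega))
  have h4 := hE.rel_of_cross' hs (hy a b hab hlt) h3 (hrel a) (hrel b)
  have := hd _ _ (E.trans (E.symm (hrel b)) (E.trans (E.symm h4) (hrel a))) h3
  rw [perm_inv_perm, perm_inv_perm] at this
  omega

lemma mem_incr_iff_mul_mem_of_separated (hE : E.IsInterval) (hs : E.Separated) {u y d : W n}
    (hu : u ∈ E.incr) (hd : d ∈ D.incr) (h : y * d⁻¹ ∈ E.stab) :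
    y ∈ D.incr ↔ u * y ∈ (E.pull d ⊓ D).incr := by
  have hrel := rel_of_mul_inv_mem h
  have hyd : ∀ a b, E.rel (perm d a) (perm d b) → E.rel (perm y a) (perm y b) := fun a b hab =>
    E.trans (hrel a) (E.trans hab (E.symm (hrel b)))
  refine ⟨fun hy a b hab hlt => hu _ _ (hyd a b hab.1) (hy _ _ hab.2 hlt), fun hw => ?_⟩
  intro a b hab hlt
  by_contra hge
  have h3 : (perm y b).1 < (perm y a).1 :=
    lt_of_le_of_ne (not_lt.1 hge) (perm_val_ne y (by omega))
  have h4 := hE.rel_of_cross' hs (hd a b hab hlt) h3 (E.symm (hrel a)) (E.symm (hrel b))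
  have := (incr_lt_iff hu (hyd a b h4)).1 (hw a b ⟨h4, hab⟩ hlt)
  omega

end BlockRel

section SetSum

variable (R : Type*) [CommRing R]

lemma coeff_setSum (A : Set (W n)) (w : W n) :
    (setSum R A).coeff w = if w ∈ A then 1 else 0 := by
  unfold setSum
  rw [MonoidAlgebra.coeff_sum, Finsupp.finsetSum_apply]
  simp only [MonoidAlgebra.of_apply, MonoidAlgebra.coeff_single, Finsupp.single_apply]
  rw [Finset.sum_ite_eq']
  simp

lemma setSum_empty : setSum R (∅ : Set (W n)) = 0 := by
  unfold setSum
  simp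

lemma setSum_singleton_one : setSum R ({1} : Set (W n)) = 1 := by
  unfold setSum
  simp [Finset.filter_eq', MonoidAlgebra.one_def]

lemma setSum_mul_of (A : Set (W n)) (d : W n) :
    setSum R A * MonoidAlgebra.of R (W n) d = setSum R {w | w * d⁻¹ ∈ A} := by
  ext w
  rw [MonoidAlgebra.of_apply, MonoidAlgebra.coeff_mul_single_apply, coeff_setSum, coeff_setSum]
  simp

lemma of_mul_setSum (A : Set (W n)) (d : W n) :
    MonoidAlgebra.of R (W n) d * setSum R A = setSum R {w | d⁻¹ * w ∈ A} := by
  ext w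
  rw [MonoidAlgebra.of_apply, MonoidAlgebra.coeff_single_mul_apply, coeff_setSum, coeff_setSum]
  simp

lemma setSum_eq_sum_fiber {ι : Type*} [Fintype ι] (A : Set (W n)) (f : W n → ι) :
    setSum R A = ∑ i, setSum R {w | w ∈ A ∧ f w = i} := by
  ext w
  rw [MonoidAlgebra.coeff_sum, Finsupp.finsetSum_apply, coeff_setSum]
  simp only [coeff_setSum, Set.mem_ofPred_eq]
  by_cases h : w ∈ A <;> simp [h]

/-- A product of two set sums, computed by a parametrization `φ` of the factorizations `w = x y`
of each element `w`. -/
lemma setSum_mul_setSum {ι : Type*} (A B : Set (W n)) (T : Finset ι) (F : ι → Set (W n))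
    (φ : W n → ι) (h : ∀ w, Set.BijOn φ {y | y ∈ B ∧ w * y⁻¹ ∈ A} {d | d ∈ T ∧ w ∈ F d}) :
    setSum R A * setSum R B = ∑ d ∈ T, setSum R (F d) := by
  ext w
  conv_lhs => rw [setSum.eq_def R B, Finset.mul_sum]
  rw [MonoidAlgebra.coeff_sum, Finsupp.finsetSum_apply, MonoidAlgebra.coeff_sum,
    Finsupp.finsetSum_apply]
  simp only [setSum_mul_of, coeff_setSum, Set.mem_ofPred_eq]
  rw [Finset.sum_boole, Finset.sum_boole, Finset.filter_filter]
  congr 1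
  refine Finset.card_nbij φ ?_ ?_ ?_
  · intro y hy
    have := (h w).mapsTo (x := y) (by simpa using hy)
    simpa using this
  · intro y hy y' hy' he
    exact (h w).injOn (by simpa using hy) (by simpa using hy') he
  · intro d hd
    obtain ⟨y, hy, rfl⟩ := (h w).surjOn (a := d) (by simpa using hd)
    exact ⟨y, by simpa using hy, rfl⟩

/-- The sum of the elements of `X_r` that lie in the stabilizer of `G`. -/
def bsum (G r : BlockRel n) : MonoidAlgebra R (W n) := setSum R (r.incr ∩ G.stab)

open BlockRel

/-- The common core of the product formulas. The elements `y` with `w = u y`, `u ∈ X_E`, are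
parametrized by the representatives `d` of the cosets `W_E y`; the conditions `Q` and `Q'` allow
the signs of the values of `u` to be prescribed. -/
lemma setSum_mul_bsum {G E D : BlockRel n} (hEG : E ≤ G) (Q : W n → Prop)
    (Q' : W n → W n → Prop)
    (h1 : ∀ y d, y ∈ D.incr → d⁻¹ ∈ E.incr → y * d⁻¹ ∈ E.stab → d ∈ D.incr)
    (h2 : ∀ u y d, u ∈ E.incr → d ∈ D.incr → y * d⁻¹ ∈ E.stab →
      (y ∈ D.incr ↔ u * y ∈ (E.pull d ⊓ D).incr))
    (h3 : ∀ u y d, y * d⁻¹ ∈ E.stab → (Q u ↔ Q' d (u * y))) :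
    setSum R {u | u ∈ E.incr ∧ u ∈ G.stab ∧ Q u} * bsum R G D =
      ∑ d : W n with d⁻¹ ∈ E.incr ∧ d ∈ D.incr ∧ d ∈ G.stab,
        setSum R {w | w ∈ (E.pull d ⊓ D).incr ∧ w ∈ G.stab ∧ Q' d w} := by
  choose φ hφ1 hφ2 using E.exists_left_rep
  have hEG' := stab_le_iff.2 hEG
  refine setSum_mul_setSum R _ _ _ _ φ fun w => ⟨?_, ?_, ?_⟩
  · rintro y ⟨⟨hy, hyG⟩, hu, huG, hQ⟩
    have hd := h1 y _ hy (hφ1 y) (hφ2 y)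
    have hw : w * y⁻¹ * y = w := by simp
    refine ⟨?_, ?_, ?_, ?_⟩
    · rw [Finset.mem_filter]
      refine ⟨Finset.mem_univ _, hφ1 y, hd, ?_⟩
      have := mul_mem (inv_mem (hEG' (hφ2 y))) hyG
      simpa using this
    · have := (h2 _ y _ hu hd (hφ2 y)).1 hy
      rwa [hw] at this
    · have := mul_mem huG hyG
      rwa [hw] at this
    · have := (h3 _ y _ (hφ2 y)).1 hQ
      rwa [hw] at this
  · rintro y ⟨-, hu, -⟩ y' ⟨-, hu', -⟩ he
    have h4 : y' * y⁻¹ ∈ E.stab := by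
      have := mul_mem (hφ2 y') (inv_mem (hφ2 y))
      rw [← he] at this
      simpa [mul_assoc] using this
    have h5 := left_rep_unique (r := E) (d := y * w⁻¹) (d' := y' * w⁻¹) (by simpa using hu)
      (by simpa using hu') (by simpa [mul_assoc] using h4)
    exact mul_right_cancel h5
  · rintro d ⟨hd, hwI, hwG, hQ⟩
    rw [Finset.mem_filter] at hd
    obtain ⟨-, hd1, hd2, hdG⟩ := hd
    obtain ⟨c, hc, hu⟩ := E.exists_mul_mem_incr (w * d⁻¹)
    have hyd : c⁻¹ * d * d⁻¹ ∈ E.stab := by simpa using hc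
    have hw : w * d⁻¹ * c * (c⁻¹ * d) = w := by group
    have hyG : c⁻¹ * d ∈ G.stab := mul_mem (inv_mem (hEG' hc)) hdG
    have hu' : w * (c⁻¹ * d)⁻¹ = w * d⁻¹ * c := by group
    refine ⟨c⁻¹ * d, ⟨⟨(h2 _ _ d hu hd2 hyd).2 (by rwa [hw]), hyG⟩, ?_, ?_, ?_⟩, ?_⟩
    · rw [hu']; exact hu
    · exact mul_mem hwG (inv_mem hyG)
    · rw [hu', h3 _ _ d hyd, hw]; exact hQ
    · refine left_rep_unique (hφ1 _) hd1 ?_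
      have := mul_mem hc (hφ2 (c⁻¹ * d))
      simpa [mul_assoc] using this

/-- Solomon's product formula for `x_C x_D` with `D` semi-positive, relative to `G`. -/
lemma bsum_mul_bsum {G C D : BlockRel n} (hCG : C ≤ G) (hC : C.IsInterval) (hD : D.IsInterval)
    (hs : D.SemiPos) : bsum R G C * bsum R G D =
      ∑ d : W n with d⁻¹ ∈ C.incr ∧ d ∈ D.incr ∧ d ∈ G.stab, bsum R G (C.pull d ⊓ D) := by
  have := setSum_mul_bsum R hCG (fun _ => True) (fun _ _ => True)
    (fun y d => left_rep_mem_incr hC hD hs) (fun u y d => mem_incr_iff_mul_mem hC hD hs)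
    (fun _ _ _ _ => Iff.rfl)
  simp only [and_true] at this
  exact this

/-- The factorization `X_E ∩ W_G = (X_F ∩ W_G) (X_E ∩ W_F)`. -/
lemma bsum_mul_bsum_of_le {G F E : BlockRel n} (hFG : F ≤ G) (hEF : E ≤ F) :
    bsum R G F * bsum R F E = bsum R G E := by
  have hstab := stab_le_iff.2 hFG
  have hiff : ∀ {x y : W n}, x ∈ F.incr → y ∈ F.stab → (y ∈ E.incr ↔ x * y ∈ E.incr) := by
    intro x y hx hy
    have hrel : ∀ a b, E.rel a b → F.rel (perm y a) (perm y b) := fun a b hab =>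
      F.trans (hy a) (F.trans (hEF a b hab) (F.symm (hy b)))
    exact ⟨fun h a b hab hlt => hx _ _ (hrel a b hab) (h a b hab hlt),
      fun h a b hab hlt => (incr_lt_iff hx (hrel a b hab)).1 (h a b hab hlt)⟩
  have := setSum_mul_setSum R (F.incr ∩ G.stab) (E.incr ∩ F.stab) {()}
    (fun _ => E.incr ∩ G.stab) (fun _ => ()) fun w => ⟨?_, ?_, ?_⟩
  · rw [Finset.sum_singleton] at this
    exact this
  · rintro y ⟨⟨h1, h2⟩, h3, h4⟩
    have h5 := (hiff h3 h2).1 h1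
    have h6 := mul_mem h4 (hstab h2)
    rw [inv_mul_cancel_right] at h5 h6
    exact ⟨by simp, h5, h6⟩
  · rintro y ⟨⟨-, h2⟩, h3, -⟩ y' ⟨⟨-, h2'⟩, h3', -⟩ -
    have h5 := left_rep_unique (r := F) (d := y * w⁻¹) (d' := y' * w⁻¹) (by simpa using h3)
      (by simpa using h3') (by simpa [mul_assoc] using mul_mem h2' (inv_mem h2))
    exact mul_right_cancel h5
  · rintro _ ⟨-, hw, hwG⟩
    obtain ⟨v, hv, hx⟩ := F.exists_mul_mem_incr w
    have h5 : w * v * v⁻¹ = w := by group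
    refine ⟨v⁻¹, ⟨⟨(hiff hx (inv_mem hv)).2 (by rwa [h5]), inv_mem hv⟩, ?_, ?_⟩, rfl⟩
    · rw [inv_inv]; exact hx
    · rw [inv_inv]; exact mul_mem hwG (hstab hv)

end SetSum

/-! ### Coset representatives with prescribed signs -/

/-- The positions at which the one-line notation of `w` is positive. -/
def signSet (w : W n) : Set (I n) := {a | 0 < (perm w a).1}

lemma mem_signSet {w : W n} {a : I n} : a ∈ signSet w ↔ 0 < (perm w a).1 := Iff.rfl

lemma neg_pos_iff (w : W n) (a : I n) : 0 < (perm w (-a)).1 ↔ ¬ 0 < (perm w a).1 := by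
  rw [perm_neg_val]
  have := val_ne_zero (perm w a)
  omega

lemma pos_iff_of_signSet_eq {v w : W n} (h : signSet v = signSet w) (a : I n) :
    0 < (perm v a).1 ↔ 0 < (perm w a).1 := by
  rw [← mem_signSet, h, mem_signSet]

namespace BlockRel

variable {r D E G : BlockRel n}

/-- The elements of `X_r ∩ W_G` whose values are positive precisely at the places in `η`. -/
def signedIncr (G r : BlockRel n) (η : Set (I n)) : Set (W n) :=
  {w | w ∈ r.incr ∧ w ∈ G.stab ∧ signSet w = η}

/-- Cutting the classes of `r` according to the signs of the values of `w`. -/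
def split (r : BlockRel n) (w : W n) : BlockRel n where
  rel a b := r.rel a b ∧ (0 < (perm w a).1 ↔ 0 < (perm w b).1)
  refl a := ⟨r.refl a, Iff.rfl⟩
  symm h := ⟨r.symm h.1, h.2.symm⟩
  trans h h' := ⟨r.trans h.1 h'.1, h.2.trans h'.2⟩
  neg h := ⟨r.neg h.1, by rw [neg_pos_iff, neg_pos_iff, h.2]⟩

lemma split_le (r : BlockRel n) (w : W n) : r.split w ≤ r := fun _ _ h => h.1

lemma split_separated (hr : r.IsInterval) {w : W n} (hw : w ∈ r.incr) : (r.split w).Separated := by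
  have key : ∀ a b : I n, (r.split w).rel a b → a.1 < 0 → 0 < b.1 → False := by
    rintro a b ⟨h1, h2⟩ ha hb
    have h3 := incr_pos_iff hw (hr.symmetric ha hb h1)
    have h4 := incr_pos_iff hw (hr.symmetric' ha hb h1)
    omega
  intro a b h
  have h1 := key a b h
  have h2 := key b a ((r.split w).symm h)
  have ha := val_ne_zero a
  have hb := val_ne_zero b
  constructor <;> intro h' <;> by_contra h''
  · exact h2 (by omega) h'
  · exact h1 (by omega) h'

lemma isInterval_split (hr : r.IsInterval) {w : W n} (hw : w ∈ r.incr) :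
    (r.split w).IsInterval := by
  constructor
  · rintro a b c ha hab hbc ⟨h1, h2⟩
    have h3 := hr.convex ha hab hbc h1
    have h4 := hw _ _ h3 hab
    have h5 := hw _ _ (r.trans (r.symm h3) h1) hbc
    exact ⟨h3, by omega⟩
  · intro a b ha hb h
    have := split_separated hr hw a b h
    omega

/-- Once the signs are prescribed, cutting the classes according to them loses nothing: between
places of different signs the order is already determined. -/
lemma signedIncr_split {w : W n} (hw : w ∈ r.incr) :
    signedIncr G r (signSet w) = signedIncr G (r.split w) (signSet w) := by
  ext v
  refine ⟨fun ⟨h1, h2, h3⟩ => ⟨fun a b hab => h1 a b hab.1, h2, h3⟩, fun ⟨h1, h2, h3⟩ =>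
    ⟨fun a b hab hlt => ?_, h2, h3⟩⟩
  by_cases h : 0 < (perm w a).1 ↔ 0 < (perm w b).1
  · exact h1 a b ⟨hab, h⟩ hlt
  · have h4 := hw a b hab hlt
    have h5 := pos_iff_of_signSet_eq h3 a
    have h6 := pos_iff_of_signSet_eq h3 b
    omega

/-- Joining the classes of `a` and `-a` whenever `a` and `w a` have the same sign and `G` does
not separate `a` from `-a`. -/
def merge (G E : BlockRel n) (w : W n) (hE : E.Separated) (hle : E ≤ G.split w) : BlockRel n where
  rel a b := E.rel a b ∨ (E.rel a (-b) ∧ G.rel a (-a) ∧ (0 < a.1 ↔ 0 < (perm w a).1))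
  refl a := .inl (E.refl a)
  symm {a b} h := by
    rcases h with h | ⟨h1, h2, h3⟩
    · exact .inl (E.symm h)
    · refine .inr ⟨by simpa using E.neg (E.symm h1), ?_, ?_⟩
      · simpa using G.symm (rel_neg_self_of_rel h2 (hle _ _ h1).1)
      · have h4 := hE _ _ h1
        have h5 := (hle _ _ h1).2
        rw [neg_pos_iff] at h5
        rw [val_neg] at h4
        have := val_ne_zero b
        have := val_ne_zero (perm w b)
        omega
  trans {a b c} h h' := by
    rcases h with h | ⟨h1, h2, h3⟩ <;> rcases h' with h' | ⟨h1', h2', h3'⟩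
    · exact .inl (E.trans h h')
    · refine .inr ⟨E.trans h h1', rel_neg_self_of_rel h2' (G.symm (hle _ _ h).1), ?_⟩
      rw [hE _ _ h, (hle _ _ h).2, h3']
    · exact .inr ⟨E.trans h1 (E.neg h'), h2, h3⟩
    · exact .inl (E.trans h1 (by simpa using E.neg h1'))
  neg {a b} h := by
    rcases h with h | ⟨h1, h2, h3⟩
    · exact .inl (E.neg h)
    · refine .inr ⟨E.neg h1, G.neg h2, ?_⟩
      rw [neg_pos_iff, val_neg]
      have := val_ne_zero a
      omega

section Merge

variable {w : W n} {hE : E.Separated} {hle : E ≤ G.split w}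

lemma merge_le : merge G E w hE hle ≤ G := by
  rintro a b (h | ⟨h1, h2, -⟩)
  · exact (hle _ _ h).1
  · exact G.trans h2 (by simpa using G.neg (hle _ _ h1).1)

lemma isInterval_merge (hI : E.IsInterval) : (merge G E w hE hle).IsInterval := by
  constructor
  · rintro a b c ha hab hbc (h | ⟨h1, -, -⟩)
    · exact .inl (hI.convex ha hab hbc h)
    · have := hE _ _ h1
      rw [val_neg] at this
      omega
  · rintro a b ha hb (h | ⟨-, h2, h3⟩)
    · have := hE _ _ h
      omega
    · exact .inr ⟨by simpa using E.refl a, h2, h3⟩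

lemma signedIncr_merge : signedIncr G (merge G E w hE hle) (signSet w) =
    signedIncr G E (signSet w) := by
  ext v
  refine ⟨fun ⟨h1, h2, h3⟩ => ⟨fun a b hab => h1 a b (.inl hab), h2, h3⟩, fun ⟨h1, h2, h3⟩ =>
    ⟨?_, h2, h3⟩⟩
  rintro a b (hab | ⟨h4, -, h6⟩) hlt
  · exact h1 a b hab hlt
  · have h7 := hE _ _ h4
    have h8 := (hle _ _ h4).2
    rw [neg_pos_iff] at h8
    rw [val_neg] at h7
    have h9 := pos_iff_of_signSet_eq h3 a
    have h10 := pos_iff_of_signSet_eq h3 b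
    have := val_ne_zero a
    have := val_ne_zero b
    have := val_ne_zero (perm v a)
    omega

/-- Among the elements of `X ∩ W_G` for the merged relation, those with the sign pattern of `w`
have the fewest positive values. -/
lemma pos_of_mem_merge (hG : G.IsInterval) {v : W n} (hv : v ∈ (merge G E w hE hle).incr)
    (hvG : v ∈ G.stab) {a : I n} (ha : 0 < a.1) (hwa : 0 < (perm w a).1) :
    0 < (perm v a).1 := by
  by_contra h
  have h0 := val_ne_zero (perm v a)
  have h1 : G.rel a (-a) := hG.symmetric' (by omega) ha (hvG a)
  have h2 : (merge G E w hE hle).rel a (-a) :=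
    .inr ⟨by simpa using E.refl a, h1, by omega⟩
  exact h ((incr_pos_iff hv h2).2 ha)

end Merge

end BlockRel

/-! ### The span of the `x_C` is closed under multiplication -/

section Algebra

open BlockRel

variable (R : Type*) [CommRing R]

/-- The span of the elements `∑_{x ∈ X_r ∩ W_G} x`, where `r` runs over the interval relations
finer than `G`. -/
def bspan (G : BlockRel n) : Submodule R (MonoidAlgebra R (W n)) :=
  Submodule.span R {y | ∃ r : BlockRel n, r.IsInterval ∧ r ≤ G ∧ y = bsum R G r}

variable {R}

lemma bsum_mem_bspan {G r : BlockRel n} (hr : r.IsInterval) (hle : r ≤ G) :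
    bsum R G r ∈ bspan R G := Submodule.subset_span ⟨r, hr, hle, rfl⟩

lemma bsum_eq_sum_signedIncr (G r : BlockRel n) :
    bsum R G r = ∑ η : Set (I n), setSum R (signedIncr G r η) := by
  unfold bsum
  rw [setSum_eq_sum_fiber R _ signSet]
  refine Finset.sum_congr rfl fun η _ => ?_
  congr 1
  ext w
  exact and_assoc

/-- By induction on the number of positive places with negative values: the sum over a set with
prescribed signs is some `x_C` up to sums with fewer such places. -/
lemma setSum_signedIncr_mem {G : BlockRel n} (hG : G.IsInterval) (k : ℕ) :
    ∀ (η : Set (I n)) (r : BlockRel n), r.IsInterval → r ≤ G →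
      {a : I n | 0 < a.1 ∧ a ∉ η}.ncard = k → setSum R (signedIncr G r η) ∈ bspan R G := by
  induction k using Nat.strong_induction_on with
  | _ k ih =>
    intro η r hr hle hk
    rcases (signedIncr G r η).eq_empty_or_nonempty with h0 | ⟨w, hw, hwG, rfl⟩
    · rw [h0, setSum_empty]
      exact zero_mem _
    have hsep := split_separated hr hw
    have hle' : r.split w ≤ G.split w := fun a b h => ⟨hle a b h.1, h.2⟩
    set M := merge G (r.split w) w hsep hle' with hM
    have hMI : M.IsInterval := isInterval_merge (isInterval_split hr hw)
    rw [signedIncr_split hw, ← signedIncr_merge (hE := hsep) (hle := hle'), ← hM]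
    have hsum := bsum_eq_sum_signedIncr (R := R) G M
    rw [← Finset.add_sum_erase _ _ (Finset.mem_univ (signSet w))] at hsum
    rw [eq_sub_of_add_eq hsum.symm]
    refine sub_mem (bsum_mem_bspan hMI merge_le) (sum_mem fun η' hη' => ?_)
    rcases (signedIncr G M η').eq_empty_or_nonempty with h0 | ⟨v, hv, hvG, rfl⟩
    · rw [h0, setSum_empty]
      exact zero_mem _
    refine ih _ ?_ _ _ hMI merge_le rfl
    rw [← hk]
    have hsub : ∀ a : I n, 0 < a.1 → a ∈ signSet w → a ∈ signSet v := fun a ha hwa =>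
      pos_of_mem_merge hG hv hvG ha hwa
    refine Set.ncard_lt_ncard ⟨fun a ha => ⟨ha.1, fun h => ha.2 (hsub a ha.1 h)⟩, fun hcon => ?_⟩
      (Set.toFinite _)
    -- equality of the two sets would force the sign patterns to agree
    have hpos : ∀ a : I n, 0 < a.1 → (a ∈ signSet v ↔ a ∈ signSet w) := fun a ha =>
      ⟨fun h => by
        by_contra h'
        exact (hcon ⟨ha, h'⟩ : 0 < a.1 ∧ a ∉ signSet v).2 h, hsub a ha⟩
    refine (Finset.mem_erase.1 hη').1 (Set.ext fun a => ?_)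
    by_cases ha : 0 < a.1
    · exact hpos a ha
    · have h1 := hpos (-a) (by have := val_ne_zero a; rw [val_neg]; omega)
      rw [mem_signSet, mem_signSet, neg_pos_iff, neg_pos_iff] at h1
      exact not_iff_not.1 h1

/-- The classes may be cut according to the prescribed signs, and then the product formula holds for
every `D`, with signs transported by `d`. -/
lemma setSum_signedIncr_mul_mem {G r D : BlockRel n} (hG : G.IsInterval) (hr : r.IsInterval)
    (hle : r ≤ G) (hD : D.IsInterval) (hDG : D ≤ G) (η : Set (I n)) :
    setSum R (signedIncr G r η) * bsum R G D ∈ bspan R G := by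
  rcases (signedIncr G r η).eq_empty_or_nonempty with h0 | ⟨w, hw, hwG, rfl⟩
  · rw [h0, setSum_empty, zero_mul]
    exact zero_mem _
  have hsep := split_separated hr hw
  have hEI := isInterval_split hr hw
  rw [signedIncr_split hw]
  have hprod := setSum_mul_bsum R (G := G) (E := r.split w) (D := D)
    (le_trans' (split_le r w) hle) (fun u => signSet u = signSet w)
    (fun d v => signSet v = {a | perm d a ∈ signSet w})
    (fun y d => left_rep_mem_incr_of_separated hEI hsep)
    (fun u y d => mem_incr_iff_mul_mem_of_separated hEI hsep) (fun u y d h => by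
      have hy : ∀ a, (perm y a ∈ signSet w ↔ perm d a ∈ signSet w) := fun a =>
        (rel_of_mul_inv_mem h a).2
      constructor
      · intro hu
        ext a
        rw [mem_signSet, perm_mul, pos_iff_of_signSet_eq hu]
        exact hy a
      · intro huy
        ext b
        have h1 := pos_iff_of_signSet_eq (v := u * y) (w := w * d) huy (perm y⁻¹ b)
        rw [perm_mul, perm_mul, perm_perm_inv] at h1
        rw [mem_signSet, h1, ← mem_signSet (w := w), ← hy, perm_perm_inv])
  unfold signedIncr
  rw [hprod]
  refine sum_mem fun d hd => ?_
  exact setSum_signedIncr_mem hG _ _ _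
    (isInterval_pull_inf_of_separated hEI hsep hD (Finset.mem_filter.1 hd).2.2.1)
    (le_trans' (inf_le_right' _ _) hDG) rfl

lemma mul_mem_bspan {G : BlockRel n} (hG : G.IsInterval) {x y : MonoidAlgebra R (W n)}
    (hx : x ∈ bspan R G) (hy : y ∈ bspan R G) : x * y ∈ bspan R G := by
  induction hx using Submodule.span_induction with
  | zero => rw [zero_mul]; exact zero_mem _
  | add a b _ _ ha hb => rw [add_mul]; exact add_mem ha hb
  | smul c a _ ha => rw [smul_mul_assoc]; exact Submodule.smul_mem _ _ ha
  | mem a ha =>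
    obtain ⟨r, hr, hle, rfl⟩ := ha
    induction hy using Submodule.span_induction with
    | zero => rw [mul_zero]; exact zero_mem _
    | add a b _ _ ha hb => rw [mul_add]; exact add_mem ha hb
    | smul c a _ ha => rw [mul_smul_comm]; exact Submodule.smul_mem _ _ ha
    | mem b hb =>
      obtain ⟨D, hD, hDG, rfl⟩ := hb
      rw [bsum_eq_sum_signedIncr, Finset.sum_mul]
      exact sum_mem fun η _ => setSum_signedIncr_mul_mem hG hr hle hD hDG η

lemma bsum_self (G : BlockRel n) : bsum R G G = 1 := by
  rw [← setSum_singleton_one R]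
  unfold bsum
  congr 1
  ext w
  refine ⟨fun h => eq_one_of_mem h.2 h.1, ?_⟩
  rintro rfl
  exact ⟨fun a b _ h => h, one_mem _⟩

lemma one_mem_bspan {G : BlockRel n} (hG : G.IsInterval) : 1 ∈ bspan R G := by
  rw [← bsum_self G]
  exact bsum_mem_bspan hG (le_rfl' G)

end Algebra

/-! ### Linear independence -/

namespace BlockRel

variable {r : BlockRel n}

/-- For an interval relation, the number of positive elements preceding the class of `a`. -/
def offset (r : BlockRel n) (a : I n) : ℕ := {b : I n | 0 < b.1 ∧ b.1 < a.1 ∧ ¬ r.rel b a}.ncard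

lemma IsInterval.offset_eq (hr : r.IsInterval) {a b : I n} (ha : 0 < a.1) (hab : a.1 < b.1)
    (h : r.rel a b) : r.offset a = r.offset b := by
  unfold offset
  congr 1
  ext c
  constructor
  · rintro ⟨h1, h2, h3⟩
    exact ⟨h1, by omega, fun h4 => h3 (r.trans h4 (r.symm h))⟩
  · rintro ⟨h1, h2, h3⟩
    refine ⟨h1, ?_, fun h4 => h3 (r.trans h4 h)⟩
    by_contra h4
    rcases eq_or_lt_of_le (not_lt.1 h4) with h5 | h5
    · exact h3 (by rwa [← I.ext' h5])
    · exact h3 (r.trans (r.symm (hr.convex ha h5 h2 h)) h)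

lemma IsInterval.offset_lt (hr : r.IsInterval) {a b : I n} (ha : 0 < a.1) (hab : a.1 < b.1)
    (h : ¬ r.rel a b) : r.offset a < r.offset b := by
  refine Set.ncard_lt_ncard ⟨?_, fun hcon => ?_⟩ (Set.toFinite _)
  · rintro c ⟨h1, h2, h3⟩
    exact ⟨h1, by omega, fun h4 => h3 (hr.convex h1 h2 hab h4)⟩
  · have h1 : a ∈ {c : I n | 0 < c.1 ∧ c.1 < a.1 ∧ ¬ r.rel c a} := hcon ⟨ha, hab, h⟩
    exact absurd h1.2.1 (lt_irrefl _)

/-- An element of `X_r` whose signs and descents at the positive integers detect `r`: there it is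
positive only on symmetric classes, and it is decreasing from one class to a later one of the same
kind. -/
lemma IsInterval.exists_witness (hr : r.IsInterval) : ∃ w ∈ r.incr,
    (∀ a : I n, 0 < a.1 → 0 < (perm w a).1 → r.rel a (-a)) ∧
    ∀ a b : I n, 0 < a.1 → a.1 < b.1 → (perm w a).1 < (perm w b).1 →
      (r.rel a (-a) ↔ r.rel b (-b)) → r.rel a b := by
  set N : ℤ := n + 1 with hN
  set K : ℤ := ((Nat.card (I n) : ℕ) : ℤ) with hK
  have hoff : ∀ a, (r.offset a : ℤ) ≤ K := fun a => by
    rw [hK]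
    exact_mod_cast (Set.ncard_le_card _)
  have hN0 : 0 < N := by omega
  have hmul : ∀ a, 0 ≤ N * (r.offset a : ℤ) ∧ N * (r.offset a : ℤ) ≤ N * K := fun a =>
    ⟨by positivity, mul_le_mul_of_nonneg_left (hoff a) hN0.le⟩
  -- the values on symmetric classes are made positive, those on the other classes negative; the
  -- classes of each kind are put in reverse order
  set κ₀ : I n → ℤ := fun a =>
    a.1 - N * r.offset a + if r.rel a (-a) then N * K else -N with hκ₀
  set κ : I n → ℤ := fun a => if 0 < a.1 then κ₀ a else -κ₀ (-a) with hκ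
  have hodd : ∀ a, κ (-a) = -κ a := fun a => by
    have := val_ne_zero a
    simp only [hκ, neg_neg', val_neg]
    split_ifs <;> omega
  obtain ⟨w, hw⟩ := exists_sorting κ hodd
  have hκpos : ∀ a : I n, 0 < a.1 → κ a = κ₀ a := fun a ha => by simp only [hκ, if_pos ha]
  have hsym : ∀ a : I n, 0 < a.1 → r.rel a (-a) → 0 < κ a := fun a ha h => by
    have := hmul a
    rw [hκpos a ha, hκ₀]
    simp only [if_pos h]
    omega
  have hasym : ∀ a : I n, 0 < a.1 → ¬ r.rel a (-a) → κ a < 0 := fun a ha h => by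
    have := hmul a
    have := val_le a
    rw [hκpos a ha, hκ₀]
    simp only [if_neg h]
    omega
  have hmono : ∀ a b : I n, 0 < a.1 → a.1 < b.1 → r.rel a b → κ a < κ b := fun a b ha hab h => by
    have h1 : r.rel a (-a) ↔ r.rel b (-b) :=
      ⟨fun h' => rel_neg_self_of_rel h' h, fun h' => rel_neg_self_of_rel h' (r.symm h)⟩
    rw [hκpos a ha, hκpos b (by omega), hκ₀]
    simp only [h1, hr.offset_eq ha hab h]
    omega
  refine ⟨w, fun a b hab hlt => hw a b ?_, fun a ha hwa => ?_, fun a b ha hlt hlt' hiff => ?_⟩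
  · have ha := val_ne_zero a
    have hb := val_ne_zero b
    by_cases h1 : 0 < a.1
    · exact hmono a b h1 hlt hab
    by_cases h2 : 0 < b.1
    · have h3 := hsym b h2 (hr.symmetric' (by omega) h2 hab)
      have h4 := hsym (-a) (by rw [val_neg]; omega)
        (r.neg (hr.symmetric (by omega) h2 hab))
      rw [hodd] at h4
      omega
    · have h3 := hmono (-b) (-a) (by rw [val_neg]; omega) (by rw [val_neg, val_neg]; omega)
        (r.neg (r.symm hab))
      rw [hodd, hodd] at h3
      omega
  · by_contra h
    have h1 := hasym a ha h
    have h2 := hw a (-a) (by rw [hodd]; omega)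
    rw [perm_neg_val] at h2
    omega
  · by_contra h
    have h1 : (r.offset a : ℤ) + 1 ≤ r.offset b := by exact_mod_cast hr.offset_lt ha hlt h
    have h2 : κ b < κ a := by
      have h3 : N * (r.offset a : ℤ) + N ≤ N * r.offset b := by nlinarith
      have h4 := val_le b
      rw [hκpos a ha, hκpos b (by omega), hκ₀]
      simp only [hiff]
      omega
    have := hw b a h2
    omega

/-- The number of positive elements in symmetric classes, refined by the number of related
pairs. -/
def weight (r : BlockRel n) : ℕ ×ₗ ℕ :=
  toLex ({a : I n | 0 < a.1 ∧ r.rel a (-a)}.ncard, {p : I n × I n | r.rel p.1 p.2}.ncard)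

end BlockRel

open BlockRel

/-- The elements `x_r`, for `r` running over the interval relations, are linearly independent. -/
lemma linearIndependent_bsum (R : Type*) [CommRing R] :
    LinearIndependent R
      (fun r : {r : BlockRel n // r.IsInterval} => bsum R ⊤ r.1) := by
  rw [linearIndependent_iff']
  intro s g hg
  by_contra hcon
  push Not at hcon
  obtain ⟨i, hi, hgi⟩ := hcon
  obtain ⟨r, hr, hmin⟩ := Finset.exists_min_image (s.filter fun i => g i ≠ 0)
    (fun i => i.1.weight) ⟨i, Finset.mem_filter.2 ⟨hi, hgi⟩⟩
  rw [Finset.mem_filter] at hr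
  obtain ⟨w, hw, hw1, hw2⟩ := r.2.exists_witness
  -- by minimality, `r` is the only index with nonzero coefficient whose set contains `w`
  have key : ∀ i ∈ s, g i ≠ 0 → w ∈ i.1.incr → i = r := by
    intro i hi hgi hwi
    have hmin' := hmin i (Finset.mem_filter.2 ⟨hi, hgi⟩)
    have hsub : {a : I n | 0 < a.1 ∧ i.1.rel a (-a)} ⊆ {a : I n | 0 < a.1 ∧ r.1.rel a (-a)} :=
      fun a ha => ⟨ha.1, hw1 a ha.1 ((incr_pos_iff hwi ha.2).2 ha.1)⟩
    rw [weight, weight, Prod.Lex.toLex_le_toLex] at hmin'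
    have hle := Set.ncard_le_ncard hsub (Set.toFinite _)
    obtain ⟨h1, h2⟩ : {a : I n | 0 < a.1 ∧ r.1.rel a (-a)}.ncard =
        {a : I n | 0 < a.1 ∧ i.1.rel a (-a)}.ncard ∧
        {p : I n × I n | r.1.rel p.1 p.2}.ncard ≤ {p : I n × I n | i.1.rel p.1 p.2}.ncard := by
      rcases hmin' with h | h
      · exact absurd h (not_lt.2 hle)
      · exact h
    have heq := Set.eq_of_subset_of_ncard_le hsub h1.le (Set.toFinite _)
    have hsymm : ∀ a : I n, 0 < a.1 → (i.1.rel a (-a) ↔ r.1.rel a (-a)) := fun a ha => by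
      have := Set.ext_iff.1 heq a
      exact ⟨fun h => (this.1 ⟨ha, h⟩).2, fun h => (this.2 ⟨ha, h⟩).2⟩
    have hpos : ∀ a b : I n, 0 < a.1 → a.1 < b.1 → i.1.rel a b → r.1.rel a b := by
      intro a b ha hab h
      refine hw2 a b ha hab (hwi a b h hab) ?_
      rw [← hsymm a ha, ← hsymm b (by omega)]
      exact ⟨fun h' => rel_neg_self_of_rel h' h, fun h' => rel_neg_self_of_rel h' (i.1.symm h)⟩
    have hpos' : ∀ a b : I n, 0 < a.1 → 0 < b.1 → i.1.rel a b → r.1.rel a b := by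
      intro a b ha hb h
      rcases lt_trichotomy a.1 b.1 with h' | h' | h'
      · exact hpos a b ha h' h
      · rw [I.ext' h']; exact r.1.refl b
      · exact r.1.symm (hpos b a hb h' (i.1.symm h))
    have hmix : ∀ a b : I n, a.1 < 0 → 0 < b.1 → i.1.rel a b → r.1.rel a b := by
      intro a b ha hb h
      have h1 := i.2.symmetric' ha hb h
      have h2 := hpos' (-a) b (by rw [val_neg]; omega) hb
        (i.1.trans (i.1.symm (i.2.symmetric ha hb h)) h)
      exact r.1.trans (by simpa using r.1.neg h2) (r.1.symm ((hsymm b hb).1 h1))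
    have hle' : ∀ a b : I n, i.1.rel a b → r.1.rel a b := by
      intro a b h
      have ha := val_ne_zero a
      have hb := val_ne_zero b
      rcases lt_or_gt_of_ne ha with ha | ha <;> rcases lt_or_gt_of_ne hb with hb | hb
      · exact r.1.neg_iff.1 (hpos' (-a) (-b) (by rw [val_neg]; omega) (by rw [val_neg]; omega)
          (i.1.neg h))
      · exact hmix a b ha hb h
      · exact r.1.symm (hmix b a hb ha (i.1.symm h))
      · exact hpos' a b ha hb h
    have hpair : {p : I n × I n | i.1.rel p.1 p.2} ⊆ {p : I n × I n | r.1.rel p.1 p.2} :=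
      fun p hp => hle' _ _ hp
    have heq' := Set.eq_of_subset_of_ncard_le hpair h2 (Set.toFinite _)
    exact Subtype.ext (ext' fun a b => Set.ext_iff.1 heq' (a, b))
  have hcoeff := congrArg (fun x => x.coeff w) hg
  simp only [MonoidAlgebra.coeff_sum, Finsupp.finsetSum_apply, MonoidAlgebra.coeff_smul,
    Finsupp.smul_apply, MonoidAlgebra.coeff_zero, Finsupp.zero_apply, bsum, coeff_setSum] at hcoeff
  rw [Finset.sum_eq_single r] at hcoeff
  · rw [if_pos ⟨hw, mem_stab_top w⟩] at hcoeff
    simp only [smul_eq_mul, mul_one] at hcoeff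
    exact hr.2 hcoeff
  · intro i hi hne
    by_cases hgi : g i = 0
    · rw [hgi, zero_smul]
    · rw [if_neg fun h => hne (key i hi hgi h.1), smul_zero]
  · intro h
    exact absurd hr.1 h

/-! ### Signed compositions and interval relations -/

/-- The sum of the absolute values of the first `i` entries. -/
def listOffset (l : List ℤ) (i : ℕ) : ℕ := ((l.take i).map Int.natAbs).sum

lemma listOffset_cons_zero (c : ℤ) (l : List ℤ) : listOffset (c :: l) 0 = 0 := by
  simp [listOffset]

lemma listOffset_cons_succ (c : ℤ) (l : List ℤ) (i : ℕ) :
    listOffset (c :: l) (i + 1) = c.natAbs + listOffset l i := by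
  simp [listOffset]

lemma listOffset_succ (l : List ℤ) (i : ℕ) (h : i < l.length) :
    listOffset l (i + 1) = listOffset l i + (l[i]).natAbs := by
  rw [listOffset, listOffset, List.take_add_one, List.getElem?_eq_getElem h, Option.toList_some,
    List.map_append, List.sum_append, List.map_singleton, List.sum_singleton]

lemma listOffset_mono (l : List ℤ) : Monotone (listOffset l) := by
  refine monotone_nat_of_le_succ fun i => ?_
  by_cases h : i < l.length
  · rw [listOffset_succ l i h]
    omega
  · simp [listOffset, List.take_of_length_le (show l.length ≤ i by omega),
      List.take_of_length_le (show l.length ≤ i + 1 by omega)]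

lemma listOffset_length (l : List ℤ) : listOffset l l.length = (l.map Int.natAbs).sum := by
  simp [listOffset]

lemma exists_listOffset (l : List ℤ) (k : ℕ) (h1 : 1 ≤ k) (h2 : k ≤ (l.map Int.natAbs).sum) :
    ∃ (i : ℕ) (_ : i < l.length), listOffset l i + 1 ≤ k ∧ k ≤ listOffset l (i + 1) := by
  have hex : ∃ i, k ≤ listOffset l i := ⟨l.length, by rwa [listOffset_length]⟩
  have hmin := fun i => Nat.find_min hex (m := i)
  have hspec := Nat.find_spec hex
  obtain ⟨i, hi⟩ : ∃ i, Nat.find hex = i + 1 := by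
    refine Nat.exists_eq_succ_of_ne_zero fun h => ?_
    rw [h] at hspec
    simp [listOffset] at hspec
    omega
  rw [hi] at hspec
  have h3 := hmin i (by omega)
  refine ⟨i, ?_, by omega, hspec⟩
  by_contra h4
  have := listOffset_mono l (show l.length ≤ i by omega)
  rw [listOffset_length] at this
  omega

lemma listOffset_index_unique (l : List ℤ) (k i j : ℕ) (h1 : listOffset l i + 1 ≤ k)
    (h2 : k ≤ listOffset l (i + 1)) (h3 : listOffset l j + 1 ≤ k) (h4 : k ≤ listOffset l (j + 1)) :
    i = j := by
  rcases lt_trichotomy i j with h | h | h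
  · have := listOffset_mono l (show i + 1 ≤ j by omega)
    omega
  · exact h
  · have := listOffset_mono l (show j + 1 ≤ i by omega)
    omega

namespace SignedComp

variable {C D : SignedComp n}

lemma ext' (h : C.parts = D.parts) : C = D := by
  obtain ⟨c, _, _⟩ := C
  obtain ⟨d, _, _⟩ := D
  congr

lemma mem_blockPlus {i : Fin C.parts.length} {a : I n} :
    a ∈ C.blockPlus i ↔
      (listOffset C.parts i : ℤ) + 1 ≤ a.1 ∧ a.1 ≤ listOffset C.parts (i + 1) := by
  rw [listOffset_succ _ _ i.2]
  push_cast
  exact Iff.rfl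

lemma mem_block {i : Fin C.parts.length} {a : I n} :
    a ∈ C.block i ↔ a ∈ C.blockPlus i ∨ (0 < C.parts.get i ∧ -a ∈ C.blockPlus i) := Iff.rfl

lemma pos_of_mem_blockPlus {i : Fin C.parts.length} {a : I n} (h : a ∈ C.blockPlus i) :
    0 < a.1 := by
  have := (mem_blockPlus.1 h).1
  omega

lemma exists_mem_blockPlus (C : SignedComp n) {a : I n} (ha : 0 < a.1) :
    ∃ i, a ∈ C.blockPlus i := by
  have h1 := val_le a
  obtain ⟨i, hi, h2, h3⟩ := exists_listOffset C.parts a.1.toNat (by omega)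
    (by rw [C.sum_eq]; omega)
  exact ⟨⟨i, hi⟩, mem_blockPlus.2 ⟨by simp only; omega, by simp only; omega⟩⟩

lemma blockPlus_unique {i j : Fin C.parts.length} {a : I n} (hi : a ∈ C.blockPlus i)
    (hj : a ∈ C.blockPlus j) : i = j := by
  rw [mem_blockPlus] at hi hj
  exact Fin.ext (listOffset_index_unique C.parts a.1.toNat i j (by omega) (by omega) (by omega)
    (by omega))

lemma mem_block_of_pos {i : Fin C.parts.length} {a : I n} (ha : 0 < a.1) :
    a ∈ C.block i ↔ a ∈ C.blockPlus i := by
  rw [mem_block]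
  refine ⟨fun h => h.resolve_right fun h' => ?_, .inl⟩
  have := pos_of_mem_blockPlus h'.2
  rw [val_neg] at this
  omega

lemma neg_mem_block_of_pos {i : Fin C.parts.length} {a : I n} (ha : 0 < a.1) :
    -a ∈ C.block i ↔ 0 < C.parts.get i ∧ a ∈ C.blockPlus i := by
  rw [mem_block, neg_neg']
  refine ⟨fun h => h.resolve_left fun h' => ?_, .inr⟩
  have := pos_of_mem_blockPlus h'
  rw [val_neg] at this
  omega

/-- The relation whose classes are the orbits of `W_C`: two elements are related if they lie in
the same blocks and so do their negatives. -/
def rel (C : SignedComp n) : BlockRel n where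
  rel a b := ∀ i, (a ∈ C.block i ↔ b ∈ C.block i) ∧ (-a ∈ C.block i ↔ -b ∈ C.block i)
  refl _ _ := ⟨Iff.rfl, Iff.rfl⟩
  symm h i := ⟨(h i).1.symm, (h i).2.symm⟩
  trans h h' i := ⟨(h i).1.trans (h' i).1, (h i).2.trans (h' i).2⟩
  neg {a b} h i := ⟨(h i).2, by simpa using (h i).1⟩

lemma rel_iff_of_pos {i : Fin C.parts.length} {a b : I n} (ha : a ∈ C.blockPlus i)
    (hb : 0 < b.1) : C.rel.rel a b ↔ b ∈ C.blockPlus i := by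
  have ha' := pos_of_mem_blockPlus ha
  constructor
  · intro h
    have := (h i).1
    rw [mem_block_of_pos ha', mem_block_of_pos hb] at this
    exact this.1 ha
  · intro h j
    rw [mem_block_of_pos ha', mem_block_of_pos hb, neg_mem_block_of_pos ha',
      neg_mem_block_of_pos hb]
    have : a ∈ C.blockPlus j ↔ b ∈ C.blockPlus j :=
      ⟨fun h' => blockPlus_unique ha h' ▸ h, fun h' => blockPlus_unique h h' ▸ ha⟩
    rw [this]
    exact ⟨Iff.rfl, Iff.rfl⟩

lemma rel_neg_iff_of_pos {i : Fin C.parts.length} {a : I n} (ha : a ∈ C.blockPlus i) :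
    C.rel.rel a (-a) ↔ 0 < C.parts.get i := by
  have ha' := pos_of_mem_blockPlus ha
  constructor
  · intro h
    have := (h i).1
    rw [mem_block_of_pos ha', neg_mem_block_of_pos ha'] at this
    exact (this.1 ha).1
  · intro h j
    rw [neg_neg', mem_block_of_pos ha', neg_mem_block_of_pos ha']
    have : a ∈ C.blockPlus j → 0 < C.parts.get j := fun h' => blockPlus_unique ha h' ▸ h
    tauto

lemma isInterval_rel (C : SignedComp n) : C.rel.IsInterval := by
  constructor
  · intro a b c ha hab hbc h
    obtain ⟨i, hi⟩ := C.exists_mem_blockPlus ha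
    rw [rel_iff_of_pos hi (by omega)] at h ⊢
    rw [mem_blockPlus] at *
    omega
  · intro a b ha hb h
    have ha' : 0 < (-a).1 := by rw [val_neg]; omega
    obtain ⟨i, hi⟩ := C.exists_mem_blockPlus ha'
    have h1 := ((rel_neg_iff_of_pos (a := -a) hi).2 ?_)
    · rw [neg_neg'] at h1
      exact C.rel.symm h1
    · have h2 := (h i).2
      rw [neg_mem_block_of_pos hb] at h2
      rw [mem_block_of_pos ha'] at h2
      exact (h2.1 hi).1

lemma subgroup_eq (C : SignedComp n) : C.subgroup = C.rel.stab := by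
  ext w
  constructor
  · intro h a i
    have key : ∀ a, perm w a ∈ C.block i ↔ a ∈ C.block i := fun a => by
      have h1 : perm w '' C.block i = C.block i := h i
      conv_lhs => rw [← h1]
      exact (perm w).injective.mem_set_image
    rw [← perm_neg, key, key]
    exact ⟨Iff.rfl, Iff.rfl⟩
  · intro h i
    ext a
    constructor
    · rintro ⟨b, hb, rfl⟩
      exact (h b i).1.2 hb
    · intro ha
      refine ⟨perm w⁻¹ a, ?_, perm_perm_inv w a⟩
      have := (h (perm w⁻¹ a) i).1
      rw [perm_perm_inv] at this
      exact this.1 ha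

lemma X_eq (C : SignedComp n) : C.X = C.rel.incr := by
  ext x
  rw [BlockRel.mem_incr_iff_len_le, ← subgroup_eq]
  exact Iff.rfl

lemma subset_iff : C ⊆ D ↔ C.rel ≤ D.rel := by
  rw [← BlockRel.stab_le_iff, ← subgroup_eq, ← subgroup_eq]
  exact Iff.rfl

lemma mem_blockPlus_succ (C : SignedComp n) (i : Fin C.parts.length) (j : ℕ)
    (hj : j < (C.parts.get i).natAbs) :
    ∃ a : I n, a ∈ C.blockPlus i ∧ a.1 = listOffset C.parts i + 1 + j := by
  have h1 := listOffset_succ C.parts i i.2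
  have h2 := listOffset_mono C.parts (show i + 1 ≤ C.parts.length from i.2)
  rw [listOffset_length, C.sum_eq] at h2
  rw [List.get_eq_getElem] at hj
  exact ⟨mkPos (listOffset C.parts i + 1 + j) (by omega) (by omega),
    mem_blockPlus.2 (by rw [mkPos_val]; omega), rfl⟩

lemma semiPositive_iff : C.SemiPositive ↔ C.rel.SemiPos := by
  constructor
  · intro h a b ha hab hr
    obtain ⟨i, hi⟩ := C.exists_mem_blockPlus ha
    rw [rel_iff_of_pos hi (by omega)] at hr
    rw [rel_neg_iff_of_pos hi]
    have h1 := h _ (C.parts.get_mem i)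
    rw [mem_blockPlus, listOffset_succ _ _ i.2] at hi hr
    rw [List.get_eq_getElem] at h1 ⊢
    omega
  · intro h c hc
    obtain ⟨i, rfl⟩ := List.get_of_mem hc
    by_contra hlt
    obtain ⟨a, ha, ha'⟩ := C.mem_blockPlus_succ i 0 (by omega)
    obtain ⟨b, hb, hb'⟩ := C.mem_blockPlus_succ i 1 (by omega)
    have := h a b (pos_of_mem_blockPlus ha) (by omega)
      ((rel_iff_of_pos ha (pos_of_mem_blockPlus hb)).2 hb)
    rw [rel_neg_iff_of_pos ha] at this
    omega

/-- A signed composition is determined by the orbits of its subgroup. -/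
lemma rel_injective (h : C.rel = D.rel) : C = D := by
  -- the part following a common initial segment is determined by the class of the next integer
  have key : ∀ {C D : SignedComp n}, C.rel = D.rel → ∀ i : ℕ,
      C.parts.take i = D.parts.take i → ∀ hi : i < C.parts.length,
      ∃ hi' : i < D.parts.length, C.parts[i] = D.parts[i] := by
    intro C D h i hi hlt
    have hoff : listOffset C.parts i = listOffset D.parts i := by
      simp only [listOffset, hi]
    have hne := C.ne_zero _ (List.getElem_mem hlt)
    obtain ⟨a, ha, ha'⟩ := C.mem_blockPlus_succ ⟨i, hlt⟩ 0 (by simp; omega)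
    have hlt' : i < D.parts.length := by
      by_contra h'
      have h1 := listOffset_mono D.parts (show D.parts.length ≤ i by omega)
      have h2 := val_le a
      rw [listOffset_length, D.sum_eq] at h1
      simp only at ha'
      omega
    have hne' := D.ne_zero _ (List.getElem_mem hlt')
    refine ⟨hlt', ?_⟩
    have hb : a ∈ D.blockPlus ⟨i, hlt'⟩ := by
      rw [mem_blockPlus, listOffset_succ _ _ hlt']
      simp only at ha' ⊢
      omega
    have hsize : ∀ {C D : SignedComp n} (hC : i < C.parts.length) (hD : i < D.parts.length),
        C.rel = D.rel → listOffset C.parts i = listOffset D.parts i →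
        a ∈ C.blockPlus ⟨i, hC⟩ → a ∈ D.blockPlus ⟨i, hD⟩ →
        (C.parts[i]).natAbs ≤ (D.parts[i]).natAbs := by
      intro C D hC hD h hoff ha hb
      by_contra hcon
      obtain ⟨b, hb1, hb2⟩ := C.mem_blockPlus_succ ⟨i, hC⟩ (D.parts[i]).natAbs
        (by simp; omega)
      have hb0 := pos_of_mem_blockPlus hb1
      rw [← rel_iff_of_pos ha hb0, h, rel_iff_of_pos hb hb0, mem_blockPlus, listOffset_succ _ _ hD] at hb1
      simp only at hb1 hb2
      omega
    have h1 := hsize hlt hlt' h hoff ha hb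
    have h2 := hsize hlt' hlt h.symm hoff.symm hb ha
    have h3 := rel_neg_iff_of_pos ha
    rw [h, rel_neg_iff_of_pos hb] at h3
    simp only [List.get_eq_getElem] at h3
    omega
  have htake : ∀ i, C.parts.take i = D.parts.take i := by
    intro i
    induction i with
    | zero => simp
    | succ i ih =>
      rw [List.take_add_one, List.take_add_one, ih]
      congr 2
      by_cases h1 : i < C.parts.length
      · obtain ⟨h2, h3⟩ := key h i ih h1
        rw [List.getElem?_eq_getElem h1, List.getElem?_eq_getElem h2, h3]
      · by_cases h2 : i < D.parts.length
        · exact absurd (key h.symm i ih.symm h2).1 h1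
        · rw [List.getElem?_eq_none (by omega), List.getElem?_eq_none (by omega)]
  refine ext' ?_
  have := htake (max C.parts.length D.parts.length)
  rwa [List.take_of_length_le (by omega), List.take_of_length_le (by omega)] at this

/-- The entries of the signed composition attached to an interval relation, from the position `s`
on, where `s` is not inside a class. -/
lemma exists_parts {r : BlockRel n} (hr : r.IsInterval) (m : ℕ) : ∀ s : ℕ, s + m = n →
    (∀ b c : I n, 0 < b.1 → b.1 ≤ s → (s : ℤ) < c.1 → ¬ r.rel b c) →
    ∃ l : List ℤ, (∀ c ∈ l, c ≠ 0) ∧ (l.map Int.natAbs).sum = m ∧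
      ∀ (i : ℕ) (hi : i < l.length), ∀ a b : I n, (s : ℤ) + listOffset l i + 1 ≤ a.1 →
        a.1 ≤ s + listOffset l (i + 1) → 0 < b.1 →
        ((r.rel a b ↔ (s : ℤ) + listOffset l i + 1 ≤ b.1 ∧ b.1 ≤ s + listOffset l (i + 1)) ∧
          (r.rel a (-a) ↔ 0 < l[i])) := by
  induction m using Nat.strong_induction_on with
  | _ m ih =>
    intro s hs hcut
    rcases Nat.eq_zero_or_pos m with rfl | hm
    · exact ⟨[], by simp, by simp, fun i hi => absurd hi (by simp)⟩
    set f : I n := mkPos (s + 1) (by omega) (by omega) with hf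
    have hfv : f.1 = s + 1 := rfl
    obtain ⟨t, ht, hmax⟩ := Set.exists_max_image {b : I n | r.rel f b} (fun b => b.1)
      (Set.toFinite _) ⟨f, r.refl f⟩
    have htf := hmax f (r.refl f)
    have htn := val_le t
    have hclass : ∀ b : I n, 0 < b.1 → (r.rel f b ↔ (s : ℤ) + 1 ≤ b.1 ∧ b.1 ≤ t.1) := by
      intro b hb
      constructor
      · intro h
        refine ⟨?_, hmax b h⟩
        by_contra h'
        exact hcut b f hb (by omega) (by omega) (r.symm h)
      · rintro ⟨h1, h2⟩
        rcases eq_or_lt_of_le h1 with h3 | h3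
        · rw [I.ext' (a := b) (b := f) (by omega)]
          exact r.refl f
        rcases eq_or_lt_of_le h2 with h4 | h4
        · rw [I.ext' (a := b) (b := t) h4]
          exact ht
        · exact hr.convex (by omega) (by omega) h4 ht
    obtain ⟨l, hl1, hl2, hl3⟩ := ih (n - t.1.toNat) (by omega) t.1.toNat (by omega) (by
      intro b c hb hbt hct hbc
      by_cases h : b.1 ≤ s
      · exact hcut b c hb h (by omega) hbc
      · have h1 := (hclass b hb).2 ⟨by omega, by omega⟩
        have := hmax c (r.trans h1 hbc)
        omega)
    -- `t` is the last element of the class of `s + 1`, which gives the next entry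
    set c : ℤ := if r.rel f (-f) then t.1 - s else -(t.1 - s) with hc
    have hcabs : (c.natAbs : ℤ) = t.1 - s := by
      rw [hc]
      split_ifs <;> omega
    refine ⟨c :: l, ?_, ?_, ?_⟩
    · intro d hd
      rcases List.mem_cons.1 hd with rfl | hd
      · omega
      · exact hl1 d hd
    · rw [List.map_cons, List.sum_cons, hl2]
      omega
    · intro i hi a b ha1 ha2 hb
      rcases i with _ | i
      · rw [listOffset_succ _ _ hi] at *
        rw [listOffset_cons_zero] at *
        simp only [List.getElem_cons_zero] at *
        have hfa := (hclass a (by omega)).2 ⟨by omega, by omega⟩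
        constructor
        · have : r.rel a b ↔ r.rel f b := ⟨r.trans hfa, r.trans (r.symm hfa)⟩
          rw [this, hclass b hb]
          omega
        · have : r.rel a (-a) ↔ r.rel f (-f) :=
            ⟨fun h => BlockRel.rel_neg_self_of_rel h (r.symm hfa),
              fun h => BlockRel.rel_neg_self_of_rel h hfa⟩
          rw [this, hc]
          split_ifs with h
          · simp only [h, true_iff]
            omega
          · simp only [h, false_iff]
            omega
      · have := hl3 i (by simpa using hi) a b
        rw [listOffset_cons_succ] at *
        rw [listOffset_cons_succ] at *
        simp only [List.getElem_cons_succ] at *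
        push_cast at *
        have h1 := this (by omega) (by omega) hb
        rw [h1.1, h1.2]
        constructor
        · omega
        · rfl

/-- Every interval relation comes from a signed composition. -/
lemma exists_rel_eq {r : BlockRel n} (hr : r.IsInterval) : ∃ C : SignedComp n, C.rel = r := by
  obtain ⟨l, h1, h2, h3⟩ := exists_parts hr n 0 (by omega) (by
    intro b c hb hb'
    push_cast at hb'
    omega)
  set C : SignedComp n := ⟨l, h1, h2⟩ with hC
  have key : ∀ (i : Fin l.length) (a b : I n), a ∈ C.blockPlus i → 0 < b.1 →
      ((r.rel a b ↔ b ∈ C.blockPlus i) ∧ (r.rel a (-a) ↔ 0 < l.get i)) := by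
    intro i a b ha hb
    have := h3 i i.2 a b
    rw [mem_blockPlus] at ha
    have h4 := this (by push_cast; simp only [hC] at ha; omega)
      (by push_cast; simp only [hC] at ha; omega) hb
    refine ⟨?_, h4.2⟩
    rw [mem_blockPlus, h4.1]
    simp [hC]
  have hpos : ∀ a b : I n, 0 < a.1 → 0 < b.1 → (C.rel.rel a b ↔ r.rel a b) := fun a b ha hb => by
    obtain ⟨i, hi⟩ := C.exists_mem_blockPlus ha
    rw [rel_iff_of_pos hi hb, (key i a b hi hb).1]
  have hneg : ∀ a : I n, 0 < a.1 → (C.rel.rel a (-a) ↔ r.rel a (-a)) := fun a ha => by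
    obtain ⟨i, hi⟩ := C.exists_mem_blockPlus ha
    rw [rel_neg_iff_of_pos hi, (key i a a hi ha).2]
  have hmix : ∀ a b : I n, a.1 < 0 → 0 < b.1 → (C.rel.rel a b ↔ r.rel a b) := by
    have aux : ∀ r s : BlockRel n, r.IsInterval →
        (∀ a b : I n, 0 < a.1 → 0 < b.1 → (r.rel a b ↔ s.rel a b)) →
        (∀ a : I n, 0 < a.1 → (r.rel a (-a) ↔ s.rel a (-a))) →
        ∀ a b : I n, a.1 < 0 → 0 < b.1 → r.rel a b → s.rel a b := by
      intro r s hr hpos hneg a b ha hb h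
      have h1 := hr.symmetric' ha hb h
      have h2 := (hpos (-a) b (by rw [val_neg]; omega) hb).1
        (r.trans (r.symm (hr.symmetric ha hb h)) h)
      exact s.trans (by simpa using s.neg h2) (s.symm ((hneg b hb).1 h1))
    exact fun a b ha hb => ⟨aux _ _ C.isInterval_rel hpos hneg a b ha hb,
      aux _ _ hr (fun a b ha hb => (hpos a b ha hb).symm) (fun a ha => (hneg a ha).symm)
        a b ha hb⟩
  refine ⟨C, BlockRel.ext' fun a b => ?_⟩
  have ha := val_ne_zero a
  have hb := val_ne_zero b
  rcases lt_or_gt_of_ne ha with ha | ha <;> rcases lt_or_gt_of_ne hb with hb | hb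
  · rw [← C.rel.neg_iff, ← r.neg_iff]
    exact hpos _ _ (by rw [val_neg]; omega) (by rw [val_neg]; omega)
  · exact hmix a b ha hb
  · exact ⟨fun h => r.symm ((hmix b a hb ha).1 (C.rel.symm h)),
      fun h => C.rel.symm ((hmix b a hb ha).2 (r.symm h))⟩
  · exact hpos a b ha hb

end SignedComp

/-! ### Restriction and conjugation in the group algebra -/

section Cancel

open BlockRel

variable {R : Type*} [CommRing R]

/-- Multiplication by `x_D` is injective on `RΣ'(W_D)`: the part of `x_D y` supported on `W_D`
is `y`. -/
lemma coeff_eq_of_mem_bspan {D : BlockRel n} {y : MonoidAlgebra R (W n)} (hy : y ∈ bspan R D)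
    (w : W n) : y.coeff w = if w ∈ D.stab then (bsum R ⊤ D * y).coeff w else 0 := by
  induction hy using Submodule.span_induction with
  | zero => simp
  | add a b _ _ ha hb =>
    rw [mul_add, MonoidAlgebra.coeff_add, MonoidAlgebra.coeff_add, Finsupp.add_apply,
      Finsupp.add_apply, ha, hb]
    split_ifs <;> simp
  | smul c a _ ha =>
    rw [mul_smul_comm, MonoidAlgebra.coeff_smul, MonoidAlgebra.coeff_smul, Finsupp.smul_apply,
      Finsupp.smul_apply, ha]
    split_ifs <;> simp
  | mem a ha =>
    obtain ⟨r, -, hle, rfl⟩ := ha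
    rw [bsum_mul_bsum_of_le R (le_top' D) hle, bsum, bsum, coeff_setSum, coeff_setSum]
    simp only [Set.mem_inter_iff, SetLike.mem_coe, mem_stab_top, and_true]
    split_ifs <;> tauto

lemma eq_of_bsum_mul_eq {D : BlockRel n} {y z : MonoidAlgebra R (W n)} (hy : y ∈ bspan R D)
    (hz : z ∈ bspan R D) (h : bsum R ⊤ D * y = bsum R ⊤ D * z) : y = z := by
  ext w
  rw [coeff_eq_of_mem_bspan hy, coeff_eq_of_mem_bspan hz, h]

/-- `x_D d = x_{D'}` when `W_{D'} = d⁻¹ W_D d` and `d` is increasing on the classes of `D'`. -/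
lemma bsum_top_mul_of {D : BlockRel n} {d : W n} (hd : d ∈ (D.pull d).incr) (hd' : d⁻¹ ∈ D.incr) :
    bsum R ⊤ D * MonoidAlgebra.of R (W n) d = bsum R ⊤ (D.pull d) := by
  rw [bsum, bsum, setSum_mul_of]
  congr 1
  ext w
  simp only [Set.mem_ofPred_eq, Set.mem_inter_iff, SetLike.mem_coe, mem_stab_top, and_true]
  constructor
  · intro h a b hab hlt
    have := h _ _ hab (hd a b hab hlt)
    rwa [perm_mul, perm_mul, perm_inv_perm, perm_inv_perm] at this
  · intro h p q hpq hlt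
    refine h (perm d⁻¹ p) (perm d⁻¹ q) ?_ (hd' p q hpq hlt)
    change D.rel _ _
    rwa [perm_perm_inv, perm_perm_inv]

lemma conj_mem_incr_inter {D E : BlockRel n} {d : W n} (hd : d ∈ (D.pull d).incr)
    (hd' : d⁻¹ ∈ D.incr) (hE : E ≤ D.pull d) {x : W n} :
    d⁻¹ * x * d ∈ E.incr ∩ (D.pull d).stab ↔ x ∈ (E.pull d⁻¹).incr ∩ D.stab := by
  have hst : d⁻¹ * x * d ∈ (D.pull d).stab ↔ x ∈ D.stab := by
    rw [mem_stab_pull]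
    simp [mul_assoc]
  have key : x ∈ D.stab → (d⁻¹ * x * d ∈ E.incr ↔ x ∈ (E.pull d⁻¹).incr) := by
    intro hx
    have hrel : ∀ {p q}, D.rel p q → D.rel (perm x p) (perm x q) := fun {p q} h =>
      D.trans (hx p) (D.trans h (D.symm (hx q)))
    constructor
    · intro h p q hpq hlt
      have h1 : D.rel p q := by simpa [pull] using hE _ _ hpq
      have h2 := h (perm d⁻¹ p) (perm d⁻¹ q) hpq (hd' p q h1 hlt)
      rw [perm_mul, perm_mul, perm_mul, perm_mul, perm_perm_inv, perm_perm_inv] at h2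
      exact (incr_lt_iff hd' (hrel h1)).1 h2
    · intro h a b hab hlt
      have h1 : D.rel (perm d a) (perm d b) := hE _ _ hab
      exact hd' _ _ (hrel h1) (h (perm d a) (perm d b) (by simpa [pull] using hab)
        (hd _ _ h1 hlt))
  exact ⟨fun h => ⟨(key (hst.1 h.2)).1 h.1, hst.1 h.2⟩,
    fun h => ⟨(key h.2).2 h.1, hst.2 h.2⟩⟩

lemma of_mul_bsum_mul_of_inv {D E : BlockRel n} {d : W n} (hd : d ∈ (D.pull d).incr)
    (hd' : d⁻¹ ∈ D.incr) (hE : E ≤ D.pull d) :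
    MonoidAlgebra.of R (W n) d * bsum R (D.pull d) E * MonoidAlgebra.of R (W n) d⁻¹ =
      bsum R D (E.pull d⁻¹) := by
  rw [bsum, bsum, of_mul_setSum, setSum_mul_of]
  congr 1
  ext x
  rw [← conj_mem_incr_inter hd hd' hE]
  simp [mul_assoc]

end Cancel

/-! ### Mackey decomposition -/

namespace BlockRel

variable {C D G r : BlockRel n}

/-- Summation of a left `W_r`-invariant function on `W_G` over coset representatives. -/
lemma sum_stab_eq (hG : r ≤ G) (F : W n → ℂ) (hF : ∀ c ∈ r.stab, ∀ y, F (c * y) = F y) :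
    ∑ y : W n with y ∈ G.stab, F y =
      Nat.card r.stab * ∑ x : W n with x ∈ r.incr ∧ x ∈ G.stab, F x⁻¹ := by
  have hcard : (Nat.card r.stab : ℂ) = ((Finset.univ.filter fun c : W n => c ∈ r.stab).card : ℂ) := by
    rw [Nat.card_eq_fintype_card, Fintype.card_subtype]
  rw [hcard, ← nsmul_eq_mul, ← Finset.sum_const, ← Finset.sum_product']
  symm
  refine Finset.sum_nbij (fun p => p.1 * p.2⁻¹) ?_ ?_ ?_ ?_
  · rintro ⟨c, x⟩ h
    simp only [Finset.mem_product, Finset.mem_filter, Finset.mem_univ, true_and] at h ⊢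
    exact mul_mem (stab_le_iff.2 hG h.1) (inv_mem h.2.2)
  · rintro ⟨c, x⟩ h ⟨c', x'⟩ h' he
    simp only [Finset.coe_product, Finset.coe_filter, Finset.mem_univ, true_and, Set.mem_prod,
      Set.mem_ofPred_eq] at h h' he
    have h1 : x'⁻¹ * x⁻¹⁻¹ = c'⁻¹ * c := by
      rw [inv_inv, ← mul_left_cancel_iff (a := c'), ← mul_assoc, ← he]
      simp
    have h2 := left_rep_unique (r := r) (d := x⁻¹) (d' := x'⁻¹) (by simpa using h.2.1)
      (by simpa using h'.2.1) (by rw [h1]; exact mul_mem (inv_mem h'.1) h.1)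
    rw [h2] at he
    rw [mul_right_cancel he, inv_injective h2]
  · intro y hy
    simp only [Finset.coe_filter, Finset.mem_univ, true_and, Set.mem_ofPred_eq] at hy
    obtain ⟨d, hd, hyd⟩ := r.exists_left_rep y
    refine ⟨(y * d⁻¹, d⁻¹), ?_, by simp⟩
    simp only [Finset.coe_product, Finset.coe_filter, Finset.mem_univ, true_and, Set.mem_prod,
      Set.mem_ofPred_eq]
    refine ⟨hyd, hd, ?_⟩
    have := mul_mem (inv_mem hy) (stab_le_iff.2 hG hyd)
    simpa using this
  · rintro ⟨c, x⟩ h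
    simp only [Finset.mem_product, Finset.mem_filter, Finset.mem_univ, true_and] at h
    exact (hF c h.1 _).symm

/-- The elements of `X_{CD}` lie in distinct double cosets: if `d'` is in `W_C d e`, where `e⁻¹` is
a distinguished representative modulo the intersection of `W_D` and the conjugate of `W_C`, then
`e` is trivial. -/
lemma eq_one_of_double_coset (hC : C.IsInterval) (hD : D.IsInterval) (hs : D.SemiPos)
    {d d' e : W n} (hd : d ∈ D.incr) (hd' : d' ∈ D.incr) (he : e ∈ D.stab)
    (he' : e⁻¹ ∈ (C.pull d ⊓ D).incr) (h : d' * (d * e)⁻¹ ∈ C.stab) : e = 1 := by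
  have hrel : ∀ p, C.rel (perm d' (perm e⁻¹ p)) (perm d p) := fun p => by
    have := rel_of_mul_inv_mem h (perm e⁻¹ p)
    rwa [perm_mul, perm_perm_inv] at this
  have hpos : ∀ p : I n, D.rel p (-p) → 0 < p.1 → 0 < (perm e⁻¹ p).1 := by
    intro p h1 h2
    have hdp := (incr_pos_iff hd h1).2 h2
    have h1' : D.rel (perm e⁻¹ p) (-perm e⁻¹ p) :=
      rel_neg_self_of_rel h1 (D.symm (D.stab.inv_mem he p))
    by_contra h3
    have h4 := mt (incr_pos_iff hd' h1').1 h3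
    have h5 := val_ne_zero (perm d' (perm e⁻¹ p))
    have h6 := hC.symmetric' (by omega) hdp (hrel p)
    rw [← perm_neg] at h6
    exact h3 ((incr_pos_iff he' (a := p) ⟨h6, h1⟩).2 h2)
  have key : ∀ p q : I n, D.rel p q → 0 < p.1 → p.1 < q.1 →
      (perm e⁻¹ p).1 < (perm e⁻¹ q).1 := by
    intro p q hpq hp hlt
    have h1 := hD.rel_neg_self hs hlt hpq
    have h2 := rel_neg_self_of_rel h1 hpq
    by_contra hge
    have h3 : (perm e⁻¹ q).1 < (perm e⁻¹ p).1 :=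
      lt_of_le_of_ne (not_lt.1 hge) (perm_val_ne _ (by omega))
    have h4 : D.rel (perm e⁻¹ q) (perm e⁻¹ p) :=
      D.trans (D.stab.inv_mem he q) (D.trans (D.symm hpq) (D.symm (D.stab.inv_mem he p)))
    have h5 : D.rel (perm e⁻¹ q) (-perm e⁻¹ q) :=
      rel_neg_self_of_rel h2 (D.symm (D.stab.inv_mem he q))
    have h6 := hC.rel_of_cross ((incr_pos_iff hd h1).2 hp)
      ((incr_pos_iff hd' h5).2 (hpos q h2 (by omega))) (hd p q hpq hlt) (hd' _ _ h4 h3)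
      (C.symm (hrel p)) (C.symm (hrel q))
    have := he' p q ⟨h6, hpq⟩ hlt
    omega
  rw [← inv_eq_one]
  refine eq_one_of_mem (D.stab.inv_mem he) fun p q hpq hlt => ?_
  have hp := val_ne_zero p
  have hq := val_ne_zero q
  have h1 := hD.rel_neg_self hs hlt hpq
  by_cases h3 : 0 < p.1
  · exact key p q hpq h3 hlt
  by_cases h4 : 0 < q.1
  · have h5 := hpos q (rel_neg_self_of_rel h1 hpq) h4
    have h6 := hpos (-p) (D.neg h1) (by rw [val_neg]; omega)
    rw [perm_neg_val] at h6
    omega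
  · have := key (-q) (-p) (D.neg (D.symm hpq)) (by rw [val_neg]; omega)
      (by rw [val_neg, val_neg]; omega)
    rw [perm_neg_val, perm_neg_val] at this
    omega

/-- Mackey decomposition for functions on `W_C \ W_n`. -/
lemma sum_incr_inv_eq (hC : C.IsInterval) (hD : D.IsInterval) (hs : D.SemiPos) (F : W n → ℂ)
    (hF : ∀ c ∈ C.stab, ∀ y, F (c * y) = F y) :
    ∑ x : W n with x ∈ C.incr, F x⁻¹ =
      ∑ d : W n with d⁻¹ ∈ C.incr ∧ d ∈ D.incr,
        ∑ x : W n with x ∈ (C.pull d ⊓ D).incr ∧ x ∈ D.stab, F (d * x⁻¹) := by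
  -- the bijection sends `(d, x)` to the representative of the coset `W_C d x⁻¹`
  choose φ hφ1 hφ2 using C.exists_left_rep
  have hφ : ∀ {y f}, f⁻¹ ∈ C.incr → f * y⁻¹ ∈ C.stab → φ y = f := fun {y f} h1 h2 =>
    left_rep_unique (hφ1 y) h1 (by simpa [mul_assoc] using mul_mem h2 (hφ2 y))
  rw [Finset.sum_sigma']
  symm
  refine Finset.sum_nbij (fun p => (φ (p.1 * p.2⁻¹))⁻¹) ?_ ?_ ?_ ?_
  · rintro ⟨d, x⟩ -
    simpa using hφ1 (d * x⁻¹)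
  · rintro ⟨d, x⟩ h ⟨d', x'⟩ h' he
    simp only [Finset.coe_sigma, Finset.coe_filter, Finset.mem_univ, true_and, Set.mem_sigma_iff,
      Set.mem_ofPred_eq] at h h' he
    obtain ⟨⟨hd1, hd2⟩, hx1, hx2⟩ := h
    obtain ⟨⟨hd1', hd2'⟩, hx1', hx2'⟩ := h'
    have h1 : d' * (d * (x⁻¹ * x'))⁻¹ ∈ C.stab := by
      have := mul_mem (hφ2 (d' * x'⁻¹)) (inv_mem (hφ2 (d * x⁻¹)))
      rw [inv_injective he] at this
      simpa [mul_assoc] using this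
    obtain ⟨e, he1, he2⟩ := (C.pull d ⊓ D).exists_left_rep (x⁻¹ * x')
    have heD := (stab_le_iff.2 (inf_le_right' (C.pull d) D)) he2
    have heC := mem_stab_pull.1 (stab_le_iff.2 (fun _ _ h => h.1 : C.pull d ⊓ D ≤ C.pull d) he2)
    have hxx := mul_mem (inv_mem hx2) hx2'
    have h2 : e = 1 := by
      refine eq_one_of_double_coset hC hD hs hd2 hd2' ?_ he1 (d' := d') ?_
      · rw [show e = (x⁻¹ * x' * e⁻¹)⁻¹ * (x⁻¹ * x') by group]
        exact mul_mem (inv_mem heD) hxx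
      · simpa [mul_assoc] using mul_mem h1 heC
    subst h2
    rw [inv_one, mul_one] at heC he2
    have h3 : d = d' := left_rep_unique hd1 hd1' (by simpa [mul_assoc] using mul_mem h1 heC)
    subst h3
    have h4 := (mul_mem_incr_iff hx1 he2).1 (by simpa using hx1')
    rw [inv_mul_eq_one] at h4
    rw [h4]
  · intro x hx
    simp only [Finset.coe_filter, Finset.mem_univ, true_and, Set.mem_ofPred_eq] at hx
    obtain ⟨w, hw, hy⟩ := D.exists_mul_mem_incr x⁻¹
    have hd := left_rep_mem_incr hC hD hs hy (hφ1 _) (hφ2 _)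
    have hdC := hφ1 (x⁻¹ * w)
    have hyd := hφ2 (x⁻¹ * w)
    set d := φ (x⁻¹ * w)
    obtain ⟨e, he1, he2⟩ := (C.pull d ⊓ D).exists_left_rep w⁻¹
    have heD := (stab_le_iff.2 (inf_le_right' (C.pull d) D)) he2
    have heC := mem_stab_pull.1 (stab_le_iff.2 (fun _ _ h => h.1 : C.pull d ⊓ D ≤ C.pull d) he2)
    refine ⟨⟨d, e⁻¹⟩, ?_, ?_⟩
    · simp only [Finset.coe_sigma, Finset.coe_filter, Finset.mem_univ, true_and,
        Set.mem_sigma_iff, Set.mem_ofPred_eq]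
      refine ⟨⟨hdC, hd⟩, he1, ?_⟩
      simpa using mul_mem hw heD
    · have : φ (d * e⁻¹⁻¹) = x⁻¹ := hφ (by simpa using hx) (by
        have := mul_mem hyd heC
        simpa [mul_assoc] using this)
      change (φ (d * e⁻¹⁻¹))⁻¹ = x
      rw [this, inv_inv]
  · rintro ⟨d, x⟩ -
    simp only [inv_inv]
    have := hF _ (hφ2 (d * x⁻¹)) (φ (d * x⁻¹))
    rw [← this]
    simp

end BlockRel

lemma indFun_one_eq {G : Type} [Group G] [Fintype G] (H : Subgroup G) (g : G) :
    indFun H (fun _ => 1) g =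
      (Nat.card H : ℂ)⁻¹ * ∑ y : G, if y * g * y⁻¹ ∈ H then 1 else 0 := by
  have h1 : indFun H (fun _ => 1) g =
      (Nat.card H : ℂ)⁻¹ * ∑ y : G, if y⁻¹ * g * y ∈ H then 1 else 0 := by
    simp only [indFun, dite_eq_ite]
    congr!
  rw [h1, ← Equiv.sum_comp (Equiv.inv G)]
  simp

/-- The Mackey formula for the permutation characters `Ind 1`. -/
lemma resChar_indOne {C D : BlockRel n} (hC : C.IsInterval) (hD : D.IsInterval) (hs : D.SemiPos)
    (H K : Subgroup (W n)) (hH : H = C.stab) (hK : K = D.stab) :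
    resChar K (indOne H) = ∑ d : W n with d⁻¹ ∈ C.incr ∧ d ∈ D.incr,
      indOne ((C.pull d ⊓ D).stab.subgroupOf K) := by
  subst hH hK
  apply Subtype.ext
  funext g
  rw [AddSubmonoidClass.coe_finsetSum, Finset.sum_apply]
  change indFun C.stab (fun _ => 1) (g : W n) = ∑ d : W n with d⁻¹ ∈ C.incr ∧ d ∈ D.incr,
    indFun ((C.pull d ⊓ D).stab.subgroupOf D.stab) (fun _ => 1) g
  set F : W n → ℂ := fun y => if y * g * y⁻¹ ∈ C.stab then 1 else 0 with hFdef
  have hF : ∀ c ∈ C.stab, ∀ y, F (c * y) = F y := by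
    intro c hc y
    have : c * y * g * (c * y)⁻¹ ∈ C.stab ↔ y * g * y⁻¹ ∈ C.stab := by
      rw [show c * y * g * (c * y)⁻¹ = c * (y * g * y⁻¹) * c⁻¹ by group,
        Subgroup.mul_mem_cancel_right _ (inv_mem hc), Subgroup.mul_mem_cancel_left _ hc]
    simp only [hFdef, this]
  have hne : ∀ H : Subgroup (W n), (Nat.card H : ℂ) ≠ 0 := fun H => by
    exact_mod_cast Nat.card_pos.ne'
  have hL : indFun C.stab (fun _ => 1) (g : W n) = ∑ x : W n with x ∈ C.incr, F x⁻¹ := by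
    have h1 := BlockRel.sum_stab_eq (BlockRel.le_top' C) F hF
    simp only [BlockRel.mem_stab_top, and_true, Finset.filter_true] at h1
    rw [indFun_one_eq, h1, inv_mul_cancel_left₀ (hne _)]
  rw [hL, BlockRel.sum_incr_inv_eq hC hD hs F hF]
  refine Finset.sum_congr rfl fun d _ => ?_
  have hle := BlockRel.inf_le_right' (C.pull d) D
  have h1 := BlockRel.sum_stab_eq (r := C.pull d ⊓ D) hle (fun y => F (d * y)) (fun c hc y => by
    have h2 := BlockRel.mem_stab_pull.1
      (BlockRel.stab_le_iff.2 (fun _ _ h => h.1 : C.pull d ⊓ D ≤ C.pull d) hc)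
    have h3 := hF _ h2 (d * y)
    rw [← h3]
    congr 1
    group)
  rw [indFun_one_eq, Nat.card_congr
    (Subgroup.subgroupOfEquivOfLe (BlockRel.stab_le_iff.2 hle)).toEquiv]
  rw [← inv_mul_cancel_left₀ (hne (C.pull d ⊓ D).stab)
    (∑ x : W n with x ∈ (C.pull d ⊓ D).incr ∧ x ∈ D.stab, F (d * x⁻¹)), ← h1]
  congr 1
  rw [← Finset.sum_subtype_of_mem (p := fun y => y ∈ D.stab) (fun y => F (d * y))
    (fun y hy => (Finset.mem_filter.1 hy).2), Finset.subtype_eq_univ.2 (fun y hy => by simpa using hy)]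
  refine Finset.sum_congr rfl fun y _ => ?_
  have : y * g * y⁻¹ ∈ (C.pull d ⊓ D).stab.subgroupOf D.stab ↔
      d * y * g * (d * y)⁻¹ ∈ C.stab := by
    rw [Subgroup.mem_subgroupOf, BlockRel.stab_inf, Subgroup.mem_inf, BlockRel.mem_stab_pull]
    rw [and_iff_left (y * g * y⁻¹).2]
    simp [mul_assoc]
  simp only [hFdef, this]

/-! ### The orbits of the group generated by `S_C` -/

namespace SignedComp

variable {C D E : SignedComp n}

lemma simple_subset (C : SignedComp n) : C.simple ⊆ C.subgroup := by
  rintro w (⟨-, h⟩ | ⟨j, hj, a, ha, hw⟩)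
  · exact h
  · have hne := C.ne_zero _ (C.parts.get_mem j)
    have hmem : a ∈ C.blockPlus j := by
      rw [mem_blockPlus, listOffset_succ _ _ j.2]
      rw [List.get_eq_getElem] at hne
      change a.1 = (listOffset C.parts j : ℤ) + 1 at ha
      omega
    rw [perm_injective (hw.trans (sw_neg_eq a).symm), subgroup_eq]
    exact BlockRel.sw_mem_stab ((rel_neg_iff_of_pos hmem).2 hj)

/-- The classes of `C.rel` are orbits of the group generated by `S_C`. -/
lemma exists_mem_closure_simple {a b : I n} (h : C.rel.rel a b) :
    ∃ g ∈ Subgroup.closure C.simple, perm g a = b := by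
  set K := Subgroup.closure C.simple with hK
  have hsymm : ∀ {a b : I n}, (∃ g ∈ K, perm g a = b) → ∃ g ∈ K, perm g b = a := by
    rintro a _ ⟨g, hg, rfl⟩
    exact ⟨g⁻¹, inv_mem hg, perm_inv_perm g a⟩
  have htrans : ∀ {a b c : I n}, (∃ g ∈ K, perm g a = b) → (∃ g ∈ K, perm g b = c) →
      ∃ g ∈ K, perm g a = c := by
    rintro a _ _ ⟨g, hg, rfl⟩ ⟨g', hg', rfl⟩
    exact ⟨g' * g, mul_mem hg' hg, rfl⟩
  have hneg : ∀ {a b : I n}, (∃ g ∈ K, perm g a = b) → ∃ g ∈ K, perm g (-a) = -b := by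
    rintro a _ ⟨g, hg, rfl⟩
    exact ⟨g, hg, perm_neg g a⟩
  have hpos : ∀ m : ℕ, ∀ a b : I n, 0 < a.1 → b.1 = a.1 + m → C.rel.rel a b →
      ∃ g ∈ K, perm g a = b := by
    intro m
    induction m with
    | zero =>
      intro a b _ hb _
      exact ⟨1, one_mem _, by rw [perm_one]; exact I.ext' (by omega)⟩
    | succ m ih =>
      intro a b ha hb hab
      have hbn := val_le b
      set b' : I n := mkPos (a.1 + m) (by omega) (by omega) with hb'
      have hv : b'.1 = a.1 + m := rfl
      have hab' : C.rel.rel a b' := by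
        rcases Nat.eq_zero_or_pos m with h | h
        · rw [I.ext' (a := b') (b := a) (by omega)]
          exact C.rel.refl a
        · exact C.isInterval_rel.convex (c := b) ha (by omega) (by omega) hab
      refine htrans (ih a b' ha hv hab') ⟨sw b' b, Subgroup.subset_closure (.inl ⟨?_, ?_⟩),
        sw_left b' b⟩
      · exact ⟨b'.1, by omega, b', b, rfl, by omega, sw_eq_mul (by omega)⟩
      · rw [subgroup_eq]
        exact BlockRel.sw_mem_stab (C.rel.trans (C.rel.symm hab') hab)
  have hpos' : ∀ a b : I n, 0 < a.1 → 0 < b.1 → C.rel.rel a b → ∃ g ∈ K, perm g a = b := by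
    intro a b ha hb hab
    rcases le_total a.1 b.1 with h | h
    · exact hpos (b.1 - a.1).toNat a b ha (by omega) hab
    · exact hsymm (hpos (a.1 - b.1).toNat b a hb (by omega) (C.rel.symm hab))
  have hrefl : ∀ a : I n, 0 < a.1 → C.rel.rel a (-a) → ∃ g ∈ K, perm g a = -a := by
    intro a ha haa
    obtain ⟨i, hi⟩ := C.exists_mem_blockPlus ha
    have hci := (rel_neg_iff_of_pos hi).1 haa
    obtain ⟨f, hf, hf'⟩ := C.mem_blockPlus_succ i 0 (by omega)
    have hf0 := pos_of_mem_blockPlus hf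
    have h1 := hpos' a f ha hf0 ((rel_iff_of_pos hi hf0).2 hf)
    have h2 : ∃ g ∈ K, perm g f = -f :=
      ⟨sw f (-f), Subgroup.subset_closure (.inr ⟨i, hci, f, hf'.trans (add_zero _), sw_neg_eq f⟩),
        sw_left f (-f)⟩
    exact htrans h1 (htrans h2 (hneg (hsymm h1)))
  have hmix : ∀ a b : I n, a.1 < 0 → 0 < b.1 → C.rel.rel a b → ∃ g ∈ K, perm g a = b := by
    intro a b ha hb hab
    have h1 := C.isInterval_rel.symmetric ha hb hab
    have h2 := hpos' (-a) b (by rw [val_neg]; omega) hb (C.rel.trans (C.rel.symm h1) hab)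
    have h3 := hrefl (-a) (by rw [val_neg]; omega) (C.rel.neg h1)
    rw [neg_neg'] at h3
    exact htrans (hsymm h3) h2
  have ha := val_ne_zero a
  have hb := val_ne_zero b
  rcases lt_or_gt_of_ne ha with ha | ha <;> rcases lt_or_gt_of_ne hb with hb | hb
  · have := hneg (hpos' (-a) (-b) (by rw [val_neg]; omega) (by rw [val_neg]; omega)
      (C.rel.neg h))
    simpa only [neg_neg'] using this
  · exact hmix a b ha hb h
  · exact hsymm (hmix b a hb ha (C.rel.symm h))
  · exact hpos' a b ha hb h

lemma rel_of_mem_closure_simple {g : W n} (hg : g ∈ Subgroup.closure C.simple) (a : I n) :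
    C.rel.rel (perm g a) a := by
  have := (Subgroup.closure_le _).2 C.simple_subset hg
  rw [subgroup_eq] at this
  exact this a

/-- Conjugating `S_D` to `S_C` by `d` forces `d` to carry the classes of `D` to those of `C`. -/
lemma rel_eq_pull_of_image_simple {d : W n} (h : (fun s => d * s * d⁻¹) '' D.simple = C.simple) :
    D.rel = C.rel.pull d := by
  have hmap : (Subgroup.closure D.simple).map (MulAut.conj d).toMonoidHom =
      Subgroup.closure C.simple := by
    rw [MonoidHom.map_closure, ← h]
    rfl
  refine BlockRel.ext' fun a b => ⟨fun hab => ?_, fun hab => ?_⟩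
  · obtain ⟨g, hg, rfl⟩ := exists_mem_closure_simple hab
    have h1 : d * g * d⁻¹ ∈ Subgroup.closure C.simple := by
      rw [← hmap]
      exact ⟨g, hg, rfl⟩
    have h2 := rel_of_mem_closure_simple h1 (perm d a)
    rw [perm_mul, perm_mul, perm_inv_perm] at h2
    exact C.rel.symm h2
  · obtain ⟨g, hg, hgb⟩ := exists_mem_closure_simple (show C.rel.rel (perm d a) (perm d b) from hab)
    rw [← hmap] at hg
    obtain ⟨g, hg, rfl⟩ := hg
    change perm (d * g * d⁻¹) (perm d a) = perm d b at hgb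
    rw [perm_mul, perm_mul, perm_inv_perm, perm_inj] at hgb
    rw [← hgb]
    exact D.rel.symm (rel_of_mem_closure_simple hg a)

/-- Semi-positivity is invariant under conjugation: it says that a class meeting more than one pair
`{k, -k}` is symmetric. -/
lemma semiPos_of_pull {d : W n} (hD : D.SemiPositive) (h : C.rel = D.rel.pull d) :
    C.SemiPositive := by
  rw [semiPositive_iff] at *
  intro a b ha hab hr
  rw [h] at hr ⊢
  change D.rel.rel (perm d a) (perm d (-a))
  rw [perm_neg]
  rcases lt_or_gt_of_ne (perm_val_ne d (a := a) (b := b) (by omega)) with h1 | h1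
  · exact D.isInterval_rel.rel_neg_self hD h1 hr
  · exact BlockRel.rel_neg_self_of_rel (D.isInterval_rel.rel_neg_self hD h1 (D.rel.symm hr))
      (D.rel.symm hr)

/-! ### The intersections `d⁻¹C ∩ D` -/

lemma isConjInter_iff {d : W n} : IsConjInter C d D E ↔ E.rel = C.rel.pull d ⊓ D.rel := by
  unfold IsConjInter
  rw [subgroup_eq, subgroup_eq, subgroup_eq, ← BlockRel.stab_pull, ← BlockRel.stab_inf]
  exact ⟨BlockRel.stab_injective, fun h => by rw [h]⟩

lemma mem_XX {d : W n} : d ∈ XX C D ↔ d⁻¹ ∈ C.rel.incr ∧ d ∈ D.rel.incr := by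
  rw [← X_eq, ← X_eq]
  exact Iff.rfl

lemma exists_isConjInter (C : SignedComp n) (hD : D.SemiPositive) {d : W n}
    (hd : d ∈ D.rel.incr) : ∃ E, IsConjInter C d D E := by
  obtain ⟨E, hE⟩ := exists_rel_eq (BlockRel.isInterval_pull_inf C.isInterval_rel D.isInterval_rel
    (semiPositive_iff.1 hD) hd)
  exact ⟨E, isConjInter_iff.2 hE⟩

lemma rel_conjInter (C : SignedComp n) (hD : D.SemiPositive) {d : W n} (hd : d ∈ D.rel.incr) :
    (conjInter C d D).rel = C.rel.pull d ⊓ D.rel := by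
  have h := exists_isConjInter C hD hd
  rw [conjInter, dif_pos h]
  exact isConjInter_iff.1 h.choose_spec

lemma conjInter_subset (C D : SignedComp n) (d : W n) : conjInter C d D ⊆ D := by
  rw [subset_iff]
  unfold conjInter
  split_ifs with h
  · rw [isConjInter_iff.1 h.choose_spec]
    exact BlockRel.inf_le_right' _ _
  · exact BlockRel.le_rfl' _

lemma isConjInter_iff_eq (C : SignedComp n) (hD : D.SemiPositive) {d : W n}
    (hd : d ∈ XX C D) : IsConjInter C d D E ↔ E = conjInter C d D := by
  rw [isConjInter_iff, ← rel_conjInter C hD (mem_XX.1 hd).2]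
  exact ⟨rel_injective, fun h => by rw [h]⟩

end SignedComp

/-! ### Linear maps on the spans -/

section Maps

variable {R : Type*} [CommRing R]

open BlockRel

lemma xElem_eq (C : SignedComp n) : xElem R C = bsum R ⊤ C.rel := by
  rw [xElem, bsum, X_eq]
  congr 1
  ext w
  simp

lemma xRel_eq (D C : SignedComp n) : xRel R D C = bsum R D.rel C.rel := by
  rw [xRel, bsum, X_eq, subgroup_eq]

lemma sig_eq : Sig R n = bspan R ⊤ := by
  unfold Sig bspan
  congr 1
  ext y
  constructor
  · rintro ⟨C, rfl⟩
    exact ⟨C.rel, C.isInterval_rel, le_top' _, xElem_eq C⟩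
  · rintro ⟨r, hr, -, rfl⟩
    obtain ⟨C, rfl⟩ := exists_rel_eq hr
    exact ⟨C, (xElem_eq C).symm⟩

lemma sigRel_eq (D : SignedComp n) : SigRel R D = bspan R D.rel := by
  unfold SigRel bspan
  congr 1
  ext y
  constructor
  · rintro ⟨C, hC, rfl⟩
    exact ⟨C.rel, C.isInterval_rel, subset_iff.1 hC, xRel_eq D C⟩
  · rintro ⟨r, hr, hle, rfl⟩
    obtain ⟨C, rfl⟩ := exists_rel_eq hr
    exact ⟨C, subset_iff.2 hle, (xRel_eq D C).symm⟩

lemma xElem_mul_xRel {D E : SignedComp n} (h : E ⊆ D) : xElem R D * xRel R D E = xElem R E := by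
  rw [xElem_eq, xElem_eq, xRel_eq]
  exact bsum_mul_bsum_of_le R (le_top' _) (subset_iff.1 h)

lemma linearIndependent_xElem : LinearIndependent R (fun C : SignedComp n => xElem R C) := by
  have h := (linearIndependent_bsum (n := n) R).comp
    (fun C : SignedComp n => ⟨C.rel, C.isInterval_rel⟩)
    fun C D h => rel_injective (congrArg Subtype.val h)
  convert h using 1
  funext C
  exact xElem_eq C

lemma linearIndependent_xRel (D : SignedComp n) :
    LinearIndependent R (fun C : {C : SignedComp n // C ⊆ D} => xRel R D C.1) := by
  refine LinearIndependent.of_comp (LinearMap.mulLeft R (xElem R D)) ?_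
  have h := (linearIndependent_xElem (R := R) (n := n)).comp
    (fun C : {C : SignedComp n // C ⊆ D} => C.1) Subtype.val_injective
  have key : LinearMap.mulLeft R (xElem R D) ∘
      (fun C : {C : SignedComp n // C ⊆ D} => xRel R D C.1) = fun C => xElem R C.1 :=
    funext fun C => xElem_mul_xRel C.2
  rw [key]
  exact h

/-- A linear map on the span of a linearly independent family is determined by arbitrary values. -/
lemma existsUnique_linearMap {ι M N : Type*} [AddCommGroup M] [Module R M] [AddCommGroup N]
    [Module R N] {v : ι → M} (hv : LinearIndependent R v) {P : Submodule R M}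
    (hP : P = Submodule.span R (Set.range v)) (g : ι → N) :
    ∃! f : P →ₗ[R] N, ∀ (i : ι) (h : v i ∈ P), f ⟨v i, h⟩ = g i := by
  subst hP
  set b := Module.Basis.span hv
  have hb : ∀ i (h : v i ∈ Submodule.span R (Set.range v)), (⟨v i, h⟩ : Submodule.span R _) = b i :=
    fun i h => (Module.Basis.span_apply hv i).symm
  refine ⟨b.constr R g, fun i h => ?_, fun f hf => b.ext fun i => ?_⟩
  · rw [hb, b.constr_basis]
  · rw [b.constr_basis, ← hb i (Submodule.subset_span ⟨i, rfl⟩), hf]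

lemma existsUnique_sig {N : Type*} [AddCommGroup N] [Module R N] (g : SignedComp n → N) :
    ∃! f : Sig R n →ₗ[R] N, ∀ C, f (xSig R C) = g C := by
  have := existsUnique_linearMap (linearIndependent_xElem (R := R) (n := n)) (P := Sig R n)
    (by unfold Sig; congr 1; ext y; simp [eq_comm]) g
  refine (existsUnique_congr fun f => ?_).1 this
  exact ⟨fun h C => h C _, fun h C _ => h C⟩

lemma existsUnique_sigRel {N : Type*} [AddCommGroup N] [Module R N] (D : SignedComp n)
    (g : SignedComp n → N) :
    ∃! f : SigRel R D →ₗ[R] N, ∀ C (h : C ⊆ D), f (xSigRel R D C h) = g C := by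
  have := existsUnique_linearMap (linearIndependent_xRel (R := R) D) (P := SigRel R D)
    (by unfold SigRel; congr 1; ext y; simp [eq_comm]) (fun C => g C.1)
  refine (existsUnique_congr fun f => ?_).1 this
  exact ⟨fun h C hC => h ⟨C, hC⟩ _, fun h C _ => h C.1 C.2⟩

lemma sig_hom_ext {N : Type*} [AddCommGroup N] [Module R N] {f g : Sig R n →ₗ[R] N}
    (h : ∀ C, f (xSig R C) = g (xSig R C)) : f = g :=
  (existsUnique_sig fun C => g (xSig R C)).unique h fun _ => rfl

lemma sigRel_hom_ext {N : Type*} [AddCommGroup N] [Module R N] {D : SignedComp n}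
    {f g : SigRel R D →ₗ[R] N}
    (h : ∀ C (hC : C ⊆ D), f (xSigRel R D C hC) = g (xSigRel R D C hC)) : f = g := by
  refine (existsUnique_sigRel D fun C => if hC : C ⊆ D then g (xSigRel R D C hC) else 0).unique
    (fun C hC => ?_) (fun C hC => ?_)
  · rw [dif_pos hC, h]
  · rw [dif_pos hC]

lemma iff_eq_choose {α : Type*} {P : α → Prop} (h : ∃! f, P f) (z f : α) :
    P f ↔ f = if h : ∃ f, P f then h.choose else z := by
  rw [dif_pos h.exists]
  exact ⟨fun hf => h.unique hf h.exists.choose_spec, fun hf => hf ▸ h.exists.choose_spec⟩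

lemma isTheta_iff (f : Sig R n →ₗ[R] RIrr R (W n)) : IsTheta R f ↔ f = theta R n :=
  iff_eq_choose (existsUnique_sig _) 0 f

lemma isThetaRel_iff (D : SignedComp n) (f : SigRel R D →ₗ[R] RIrr R D.subgroup) :
    IsThetaRel R D f ↔ f = thetaRel R D :=
  iff_eq_choose (existsUnique_sigRel D
    fun C => 1 ⊗ₜ indOne (C.subgroup.subgroupOf D.subgroup)) 0 f

/-- The image of `x_C` under `Res_D`. -/
def resVal (R : Type*) [CommRing R] (D C : SignedComp n) : SigRel R D :=
  ∑ d : W n with d ∈ XX C D, xSigRel R D (conjInter C d D) (conjInter_subset C D d)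

lemma coe_resVal (D C : SignedComp n) : (resVal R D C : MonoidAlgebra R (W n)) =
    ∑ d : W n with d ∈ XX C D, xRel R D (conjInter C d D) := by
  rw [resVal, AddSubmonoidClass.coe_finsetSum]
  rfl

lemma isRes_iff (D : SignedComp n) (f : Sig R n →ₗ[R] SigRel R D) :
    IsRes R D f ↔ f = Res R D := by
  refine iff_eq_choose ((existsUnique_congr fun f => ?_).1 (existsUnique_sig (resVal R D))) 0 f
  exact forall_congr' fun C => by rw [← coe_resVal]; exact Subtype.ext_iff

lemma res_xSig (D C : SignedComp n) : Res R D (xSig R C) = resVal R D C :=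
  Subtype.ext (((isRes_iff D _).2 rfl C).trans (coe_resVal D C).symm)

/-- The image of `x_E^D` under `Res_C^D`. -/
def resRelVal (R : Type*) [CommRing R] (D C E : SignedComp n) : SigRel R C :=
  ∑ d : W n with d ∈ XX E C ∩ D.subgroup, xSigRel R C (conjInter E d C) (conjInter_subset E C d)

lemma coe_resRelVal (D C E : SignedComp n) : (resRelVal R D C E : MonoidAlgebra R (W n)) =
    ∑ d : W n with d ∈ XX E C ∩ D.subgroup, xRel R C (conjInter E d C) := by
  rw [resRelVal, AddSubmonoidClass.coe_finsetSum]
  rfl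

lemma isResRel_iff (D C : SignedComp n) (f : SigRel R D →ₗ[R] SigRel R C) :
    IsResRel R D C f ↔ f = ResRel R D C := by
  refine iff_eq_choose
    ((existsUnique_congr fun f => ?_).1 (existsUnique_sigRel D (resRelVal R D C))) 0 f
  exact forall_congr' fun E => forall_congr' fun _ => by
    rw [← coe_resRelVal]; exact Subtype.ext_iff

lemma resRel_xSigRel (D C E : SignedComp n) (h : E ⊆ D) :
    ResRel R D C (xSigRel R D E h) = resRelVal R D C E :=
  Subtype.ext (((isResRel_iff D C _).2 rfl E h).trans (coe_resRelVal D C E).symm)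

/-! ### The properties of the restriction maps -/

/-- Both sides are given on `x_C` by the product formula for `x_C x_D`. -/
lemma xElem_mul_res {D : SignedComp n} (hD : D.SemiPositive) (x : Sig R n) :
    xElem R D * (Res R D x : MonoidAlgebra R (W n)) = x * xElem R D := by
  have key : (LinearMap.mulLeft R (xElem R D)).comp ((SigRel R D).subtype.comp (Res R D)) =
      (LinearMap.mulRight R (xElem R D)).comp (Sig R n).subtype := by
    refine sig_hom_ext fun C => ?_
    change xElem R D * (Res R D (xSig R C) : MonoidAlgebra R (W n)) = xElem R C * xElem R D
    rw [res_xSig, coe_resVal, Finset.mul_sum, xElem_eq C, xElem_eq D,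
      bsum_mul_bsum R (le_top' _) C.isInterval_rel D.isInterval_rel (semiPositive_iff.1 hD)]
    refine Finset.sum_congr (Finset.filter_congr fun d _ => ?_) fun d hd => ?_
    · rw [mem_XX]
      simp
    · rw [← xElem_eq D, xElem_mul_xRel (conjInter_subset C D d), xElem_eq, rel_conjInter C hD]
      have := (Finset.mem_filter.1 hd).2
      exact this.2.1
  exact LinearMap.congr_fun key x

/-- The relative version of `xElem_mul_res`, from the product formula inside `R W_D`. -/
lemma xRel_mul_resRel {D C : SignedComp n} (hCD : C ⊆ D) (hC : C.SemiPositive) (y : SigRel R D) :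
    xRel R D C * (ResRel R D C y : MonoidAlgebra R (W n)) = y * xRel R D C := by
  have key : (LinearMap.mulLeft R (xRel R D C)).comp ((SigRel R C).subtype.comp (ResRel R D C)) =
      (LinearMap.mulRight R (xRel R D C)).comp (SigRel R D).subtype := by
    refine sigRel_hom_ext fun E hE => ?_
    change xRel R D C * (ResRel R D C (xSigRel R D E hE) : MonoidAlgebra R (W n)) =
      xRel R D E * xRel R D C
    rw [resRel_xSigRel, coe_resRelVal, Finset.mul_sum, xRel_eq D E, xRel_eq D C,
      bsum_mul_bsum R (subset_iff.1 hE) E.isInterval_rel C.isInterval_rel (semiPositive_iff.1 hC)]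
    refine Finset.sum_congr (Finset.filter_congr fun d _ => ?_) fun d hd => ?_
    · rw [Set.mem_inter_iff, mem_XX, subgroup_eq, and_assoc]
      rfl
    · rw [xRel_eq, bsum_mul_bsum_of_le R (subset_iff.1 hCD)
        (subset_iff.1 (conjInter_subset E C d)), rel_conjInter E hC]
      have := (Finset.mem_filter.1 hd).2
      exact this.2.1
  exact LinearMap.congr_fun key y

lemma one_mem_sigRel (D : SignedComp n) : 1 ∈ SigRel R D := by
  rw [sigRel_eq]
  exact one_mem_bspan D.isInterval_rel

lemma mul_mem_sigRel (D : SignedComp n) {x y : MonoidAlgebra R (W n)} (hx : x ∈ SigRel R D)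
    (hy : y ∈ SigRel R D) : x * y ∈ SigRel R D := by
  rw [sigRel_eq] at *
  exact mul_mem_bspan D.isInterval_rel hx hy

lemma one_mem_sig : 1 ∈ Sig R n := by
  rw [sig_eq]
  exact one_mem_bspan isInterval_top

lemma mul_mem_sig {x y : MonoidAlgebra R (W n)} (hx : x ∈ Sig R n) (hy : y ∈ Sig R n) :
    x * y ∈ Sig R n := by
  rw [sig_eq] at *
  exact mul_mem_bspan isInterval_top hx hy

lemma eq_of_xElem_mul_eq {D : SignedComp n} {y z : MonoidAlgebra R (W n)} (hy : y ∈ SigRel R D)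
    (hz : z ∈ SigRel R D) (h : xElem R D * y = xElem R D * z) : y = z := by
  rw [sigRel_eq] at hy hz
  rw [xElem_eq] at h
  exact eq_of_bsum_mul_eq hy hz h

lemma res_one {D : SignedComp n} (hD : D.SemiPositive) :
    (Res R D ⟨1, one_mem_sig⟩ : MonoidAlgebra R (W n)) = 1 := by
  refine eq_of_xElem_mul_eq (Subtype.mem _) (one_mem_sigRel D) ?_
  rw [xElem_mul_res hD, one_mul, mul_one]

lemma res_mul {D : SignedComp n} (hD : D.SemiPositive) (x y : Sig R n) :
    (Res R D ⟨x * y, mul_mem_sig x.2 y.2⟩ : MonoidAlgebra R (W n)) = Res R D x * Res R D y := by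
  refine eq_of_xElem_mul_eq (Subtype.mem _) (mul_mem_sigRel D (Subtype.mem _) (Subtype.mem _)) ?_
  rw [xElem_mul_res hD, mul_assoc, ← xElem_mul_res hD y, ← mul_assoc, ← xElem_mul_res hD x,
    mul_assoc]

lemma resRel_comp_res {D C : SignedComp n} (hD : D.SemiPositive) (hCD : C ⊆ D)
    (hC : C.SemiPositive) : ResRel R D C ∘ₗ Res R D = Res R C := by
  ext1 x
  apply Subtype.ext
  refine eq_of_xElem_mul_eq (Subtype.mem _) (Subtype.mem _) ?_
  rw [xElem_mul_res hC, LinearMap.comp_apply, ← xElem_mul_xRel hCD, mul_assoc,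
    xRel_mul_resRel hCD hC, ← mul_assoc, xElem_mul_res hD, mul_assoc]

lemma resRIrr_theta {D : SignedComp n} (hD : D.SemiPositive) (x : Sig R n) :
    resRIrr R D.subgroup (theta R n x) = thetaRel R D (Res R D x) := by
  have key : (resRIrr R D.subgroup).toLinearMap ∘ₗ theta R n = thetaRel R D ∘ₗ Res R D := by
    refine sig_hom_ext fun C => ?_
    rw [LinearMap.comp_apply, LinearMap.comp_apply, (isTheta_iff (theta R n)).2 rfl C, res_xSig,
      resVal, map_sum]
    change resRIrr R D.subgroup (1 ⊗ₜ indOne C.subgroup) = _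
    have h1 : resRIrr R D.subgroup (1 ⊗ₜ indOne C.subgroup) =
        1 ⊗ₜ resChar D.subgroup (indOne C.subgroup) := by
      unfold resRIrr
      rw [Algebra.TensorProduct.map_tmul]
      rfl
    rw [h1, resChar_indOne C.isInterval_rel D.isInterval_rel (semiPositive_iff.1 hD) _ _
      (subgroup_eq C) (subgroup_eq D), TensorProduct.tmul_sum]
    refine Finset.sum_congr (Finset.filter_congr fun d _ => mem_XX.symm) fun d hd => ?_
    rw [(isThetaRel_iff D (thetaRel R D)).2 rfl, subgroup_eq (conjInter C d D),
      rel_conjInter C hD]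
    have := (Finset.mem_filter.1 hd).2
    exact (mem_XX.1 this).2
  exact LinearMap.congr_fun key x

/-- Conjugation by `d` as a map between the algebras attached to `D'` and `D`. -/
lemma exists_conj {D D' : SignedComp n} (hD : D.SemiPositive) (hD' : D'.SemiPositive) {d : W n}
    (hd : d ∈ XX D D') (h : D'.rel = D.rel.pull d) :
    ∃ dstar : SigRel R D' →ₗ[R] SigRel R D,
      (∀ y, (dstar y : MonoidAlgebra R (W n)) =
        MonoidAlgebra.of R (W n) d * y * MonoidAlgebra.of R (W n) d⁻¹) ∧
      dstar ∘ₗ Res R D' = Res R D := by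
  obtain ⟨hd1, hd2⟩ := mem_XX.1 hd
  rw [h] at hd2
  set f : MonoidAlgebra R (W n) →ₗ[R] MonoidAlgebra R (W n) :=
    (LinearMap.mulRight R (MonoidAlgebra.of R (W n) d⁻¹)).comp
      (LinearMap.mulLeft R (MonoidAlgebra.of R (W n) d)) with hf
  have hmem : ∀ y ∈ SigRel R D', f y ∈ SigRel R D := by
    have hle : SigRel R D' ≤ (SigRel R D).comap f := by
      rw [sigRel_eq, sigRel_eq]
      refine Submodule.span_le.2 ?_
      rintro _ ⟨r, hr, hle, rfl⟩
      change MonoidAlgebra.of R (W n) d * bsum R D'.rel r * MonoidAlgebra.of R (W n) d⁻¹ ∈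
        bspan R D.rel
      rw [h] at hle ⊢
      rw [of_mul_bsum_mul_of_inv hd2 hd1 hle]
      have hle' : r.pull d⁻¹ ≤ D.rel := fun p q hpq => by simpa [pull] using hle _ _ hpq
      have heq : r.pull d⁻¹ = r.pull d⁻¹ ⊓ D.rel :=
        BlockRel.ext' fun p q => ⟨fun hpq => ⟨hpq, hle' p q hpq⟩, fun hpq => hpq.1⟩
      refine bsum_mem_bspan ?_ hle'
      rw [heq]
      exact isInterval_pull_inf hr D.isInterval_rel (semiPositive_iff.1 hD) hd1
    exact fun y hy => hle hy
  refine ⟨f.restrict hmem, fun y => rfl, ?_⟩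
  ext1 x
  apply Subtype.ext
  refine eq_of_xElem_mul_eq (Subtype.mem _) (Subtype.mem _) ?_
  have hxd : xElem R D * MonoidAlgebra.of R (W n) d = xElem R D' := by
    rw [xElem_eq, xElem_eq, bsum_top_mul_of hd2 hd1, h]
  have hdd : MonoidAlgebra.of R (W n) d * MonoidAlgebra.of R (W n) d⁻¹ = 1 := by
    rw [← map_mul, mul_inv_cancel, map_one]
  change xElem R D * (MonoidAlgebra.of R (W n) d * (Res R D' x : MonoidAlgebra R (W n)) *
    MonoidAlgebra.of R (W n) d⁻¹) = _
  rw [← mul_assoc, ← mul_assoc, hxd, xElem_mul_res hD', ← hxd, xElem_mul_res hD]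
  rw [mul_assoc, mul_assoc, hdd, mul_one]

end Maps

end MantaciReutenauer

end

open MantaciReutenauer MantaciReutenauer.SignedComp
theorem mainTheorem6 {R : Type*} [CommRing R] {n : ℕ} (hn : 1 ≤ n)
    (D : SignedComp n) (hD : D.SemiPositive) :
    -- the intersections, `θ_n`, `θ_D` and `Res_D` are well defined by their defining properties
    ((∀ (C : SignedComp n), ∀ d ∈ XX C D, ∀ E, IsConjInter C d D E ↔ E = conjInter C d D) ∧
      (∀ f, IsTheta R f ↔ f = theta R n) ∧
      (∀ f, IsThetaRel R D f ↔ f = thetaRel R D) ∧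
      (∀ f, IsRes R D f ↔ f = Res R D)) ∧
    -- (a)
    (∀ x : Sig R n, xElem R D * (Res R D x : MonoidAlgebra R (W n)) = x * xElem R D) ∧
    -- (b)
    (∃ (h₁ : 1 ∈ Sig R n) (hm : ∀ x y, x ∈ Sig R n → y ∈ Sig R n → x * y ∈ Sig R n)
      (h₁' : 1 ∈ SigRel R D)
      (hm' : ∀ x y, x ∈ SigRel R D → y ∈ SigRel R D → x * y ∈ SigRel R D)
      (φ : (Sig R n).toSubalgebra h₁ hm →ₐ[R] (SigRel R D).toSubalgebra h₁' hm'),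
      ∀ (x : MonoidAlgebra R (W n)) (hx : x ∈ Sig R n),
        (φ ⟨x, hx⟩ : MonoidAlgebra R (W n)) = Res R D ⟨x, hx⟩) ∧
    -- (c)
    (∀ C : SignedComp n, C ⊆ D → C.SemiPositive →
      (∀ f, IsResRel R D C f ↔ f = ResRel R D C) ∧ ResRel R D C ∘ₗ Res R D = Res R C) ∧
    -- (d)
    (∀ x : Sig R n, resRIrr R D.subgroup (theta R n x) = thetaRel R D (Res R D x)) ∧
    -- (e)
    (∀ (D' : SignedComp n), ∀ d ∈ XX D D', (fun s => d * s * d⁻¹) '' D'.simple = D.simple →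
      D'.SemiPositive ∧
      ∃ dstar : SigRel R D' →ₗ[R] SigRel R D,
        (∀ y, (dstar y : MonoidAlgebra R (W n)) =
          MonoidAlgebra.of R (W n) d * y * MonoidAlgebra.of R (W n) d⁻¹) ∧
        dstar ∘ₗ Res R D' = Res R D) := by
  refine ⟨⟨fun C d hd E => isConjInter_iff_eq C hD hd, isTheta_iff, isThetaRel_iff D,
    isRes_iff D⟩, xElem_mul_res hD, ?_, ?_, resRIrr_theta hD, ?_⟩
  · refine ⟨one_mem_sig, fun _ _ => mul_mem_sig, one_mem_sigRel D, fun _ _ => mul_mem_sigRel D,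
      AlgHom.ofLinearMap
        { toFun := fun x => ⟨Res R D ⟨x.1, x.2⟩, (Res R D ⟨x.1, x.2⟩).2⟩
          map_add' := fun x y => Subtype.ext
            (congrArg Subtype.val (map_add (Res R D) ⟨x.1, x.2⟩ ⟨y.1, y.2⟩))
          map_smul' := fun c x => Subtype.ext
            (congrArg Subtype.val (map_smul (Res R D) c ⟨x.1, x.2⟩)) }
        (Subtype.ext (res_one hD))
        (fun x y => Subtype.ext (res_mul hD ⟨x.1, x.2⟩ ⟨y.1, y.2⟩)), fun x hx => rfl⟩
  · exact fun C hCD hC => ⟨isResRel_iff D C, resRel_comp_res hD hCD hC⟩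
  · intro D' d hd h
    have hrel := rel_eq_pull_of_image_simple h
    have hD' := semiPos_of_pull hD hrel
    exact ⟨hD', exists_conj hD hD' hd hrel⟩
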